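/- **Setting.** Let $d\ge 1$, $\alpha>0$, and let $V:\mathbb Z^d\to[0,\infty]$ satisfy $V(0)=0$ (with $e^{-\infty}=0$). Let $S$ be the set of bijections of $\mathbb Z^d$ with the product topology generated by the sets $\{\sigma:\sigma(x)=y\}$ and its Borel $\sigma$-algebra. Let $\Gamma\subset S$ be the set of finite cycles of length at least $2$; write $\{\gamma\}$ for the support of $\gamma\in\Gamma$, and $w(\gamma)=\exp\{-\alpha\sum_{x\in\{\gamma\}}V(\gamma(x)-x)\}$. For finite $\Lambda\subset\mathbb Z^d$, $G_\Lambda$ is the probability measure on $S_\Lambda=\{\sigma\in S:\sigma(x)=x\text{ for }x\notin\Lambda\}$ with $G_\Lambda(\sigma)=Z_\Lambda^{-1}\exp\{-\alpha\sum_{x\in\Lambda}V(\sigma(x)-x)\}$. A permutation all of whose cycles are finite is identified with its gas of cycles $\eta\in\{0,1\}^\Gamma$, $\eta(\gamma)=1$ if and only if $\gamma$ is one of its cycles. Let $\mathcal N$ be a Poisson process on $\Gamma\times\mathbb R\times\mathbb R^+$ with intensity $w(\gamma)\,dt\,e^{-s}ds$. For a set $\mathcal M\subseteq\Gamma\times\mathbb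 R\times\mathbb R^+$ of points and $\varphi=(\gamma,t,s)\in\Gamma\times\mathbb R\times\mathbb R^+$, let $$\mathcal A_1^\varphi(\mathcal M)=\{(\gamma',t',s')\in\mathcal M:\{\gamma'\}\cap\{\gamma\}\ne\emptyset,\ t'<t<t'+s'\},\qquad \mathcal A_{n+1}^\varphi(\mathcal M)=\bigcup_{\varphi'\in\mathcal A_n^\varphi(\mathcal M)}\mathcal A_1^{\varphi'}(\mathcal M),$$ and let the clan of ancestors of $\varphi$ be $\mathcal A^\varphi(\mathcal M)=\bigcup_{n\ge1}\mathcal A_n^\varphi(\mathcal M)$. Put $\mathcal D_0=\emptyset$ and, for $n\ge1$, $\mathcal K_n=\{\varphi\in\mathcal M:\mathcal A_1^\varphi(\mathcal M)\setminus\mathcal D_{n-1}=\emptyset\}$, $\mathcal D_n=\{\varphi\in\mathcal M:\mathcal A_1^\varphi(\mathcal M)\cap\mathcal K_n\neq\emptyset\}$, and let $\mathcal K(\mathcal M)=\bigcup_{n\ge1}\mathcal K_n$ be the set of kept points. Let $\eta_t(\mathcal M)(\gamma)$ be the number of points $(\gamma,t',s')\in\mathcal K(\mathcal M)$ with $t'\le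 t<t'+s'$. Finally, for $\Lambda\subseteq\mathbb Z^d$ let $\mathcal N^\Lambda=\{(\gamma,t,s)\in\mathcal N:\{\gamma\}\subseteq\Lambda\}$, $\eta_t^\Lambda=\eta_t(\mathcal N^\Lambda)$ and $\eta_t=\eta_t(\mathcal N)$. **Theorem (existence of almost sure thermodynamic limit).** Assume that, for almost every realization of $\mathcal N$, the clan of ancestors $\mathcal A^\varphi(\mathcal N)$ is finite for every $\varphi\in\Gamma\times\mathbb R\times\mathbb R^+$. Then: 1. For each fixed $t\in\mathbb R$ and $\gamma\in\Gamma$, almost surely $\eta_t^\Lambda(\gamma)\to\eta_t(\gamma)$ as $\Lambda\nearrow\mathbb Z^d$; that is, almost surely there is a finite set $F\subset\mathbb Z^d$ such that $\eta_t^\Lambda(\gamma)=\eta_t(\gamma)$ for all $\Lambda\supseteq F$. 2. There is a probability measure $\mu$ on $S$, supported on finite-cycle permutations, which under the above identification is the law of $\eta_t$ for every $t\in\mathbb R$, and $G_\Lambda\to\mu$ weakly as $\Lambda\nearrow\mathbb Z^d$ through finite sets. -/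

import Mathlib

open MeasureTheory ProbabilityTheory Filter Topology
open scoped ENNReal NNReal

noncomputable section

namespace CycleGas

/-- The sites of the lattice `ℤ^d`. -/
abbrev Site (d : ℕ) := Fin d → ℤ

/-- The set `S` of permutations (bijections) of `ℤ^d`. -/
abbrev Permutation (d : ℕ) := Equiv.Perm (Site d)

/-- The product topology on permutations, generated by the sets `{σ | σ x = y}`. -/
instance permTopology (d : ℕ) : TopologicalSpace (Permutation d) :=
  TopologicalSpace.induced (fun (σ : Permutation d) (x : Site d) => σ x) inferInstance

/-- The Borel σ-algebra of permutations. -/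
instance permMeasurableSpace (d : ℕ) : MeasurableSpace (Permutation d) := borel _

instance permBorelSpace (d : ℕ) : BorelSpace (Permutation d) := ⟨rfl⟩

/-! ### Cycles -/

/-- The set `Γ` of finite cycles (of length at least `2`) of `ℤ^d`. -/
def FinCycle (d : ℕ) : Type :=
  {γ : Permutation d // γ.IsCycle ∧ {x | γ x ≠ x}.Finite}

/-- The support `{γ}` of a finite cycle. -/
def FinCycle.support {d : ℕ} (γ : FinCycle d) : Finset (Site d) := γ.2.2.toFinset

lemma FinCycle.mem_support {d : ℕ} (γ : FinCycle d) (x : Site d) :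
    x ∈ γ.support ↔ γ.1 x ≠ x := by
  simp [FinCycle.support]

/-- The countable set of cycles carries the discrete σ-algebra. -/
instance cycleMeasurableSpace (d : ℕ) : MeasurableSpace (FinCycle d) := ⊤

instance cycleCountable (d : ℕ) : Countable (FinCycle d) := by
  classical
  let f : FinCycle d → Finset (Site d × Site d) := fun γ => γ.support.image fun x => (x, γ.1 x)
  have key : ∀ γ : FinCycle d, ∀ x y, (x, y) ∈ f γ ↔ γ.1 x ≠ x ∧ γ.1 x = y := by
    intro γ x y
    simp only [f, Finset.mem_image, Prod.mk.injEq, FinCycle.mem_support]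
    constructor
    · rintro ⟨a, ha, rfl, rfl⟩
      exact ⟨ha, rfl⟩
    · rintro ⟨h1, h2⟩
      exact ⟨x, h1, rfl, h2⟩
  refine Function.Injective.countable (f := f) fun γ γ' h => Subtype.ext (Equiv.ext fun x => ?_)
  by_cases h1 : γ.1 x = x
  · by_contra h2
    have h3 : (x, γ'.1 x) ∈ f γ := by
      rw [h, key]
      exact ⟨fun h4 => h2 (h1.trans h4.symm), rfl⟩
    exact h2 ((key _ _ _).1 h3).2
  · have h3 : (x, γ.1 x) ∈ f γ' := by
      rw [← h, key]
      exact ⟨h1, rfl⟩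
    exact ((key _ _ _).1 h3).2.symm

/-- Two cycles are incompatible if their supports intersect. -/
def Incompatible {d : ℕ} (γ γ' : FinCycle d) : Prop := ¬ Disjoint γ.support γ'.support

/-- Gases of cycles: `η γ` is the number of copies of the cycle `γ`. The topology and the
σ-algebra are the product ones, with `ℕ` discrete. -/
abbrev Config (d : ℕ) := FinCycle d → ℕ

/-- The gas of cycles of a permutation: `η γ = 1` if `γ` is one of the cycles in the cycle
decomposition of `σ`, and `η γ = 0` otherwise. -/
def cyclesOf {d : ℕ} (σ : Permutation d) : Config d := by
  classical
  exact fun γ => if ∀ x ∈ γ.support, σ x = γ.1 x then 1 else 0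

/-- All cycles in the decomposition of `σ` are finite. -/
def IsFiniteCyclePerm {d : ℕ} (σ : Permutation d) : Prop :=
  ∀ x, {y | σ.SameCycle x y}.Finite

/-! ### The specifications with identity boundary conditions -/

/-- The Boltzmann factor `exp (-α * E)` of an energy `E ∈ [0, ∞]`, with `exp (-∞) = 0`. -/
def boltzmann (α : ℝ) (E : ℝ≥0∞) : ℝ≥0∞ := EReal.exp (-((α : EReal) * (E : EReal)))

/-- The weight `w γ = exp (-α ∑_{x ∈ {γ}} V (γ x - x))` of a cycle. -/
def weight {d : ℕ} (V : Site d → ℝ≥0∞) (α : ℝ) (γ : FinCycle d) : ℝ≥0∞ :=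
  boltzmann α (∑ x ∈ γ.support, V (γ.1 x - x))

/-- The Hamiltonian `H_Λ σ = ∑_{x ∈ Λ} V (σ x - x)`. -/
def hamiltonian {d : ℕ} (V : Site d → ℝ≥0∞) (Λ : Finset (Site d)) (σ : Permutation d) : ℝ≥0∞ :=
  ∑ x ∈ Λ, V (σ x - x)

/-- The set `S_Λ` of permutations that are the identity outside `Λ`. -/
abbrev PermIn {d : ℕ} (Λ : Finset (Site d)) : Type :=
  {σ : Permutation d // ∀ x, x ∉ Λ → σ x = x}

/-- The normalizing constant `Z_Λ`. -/
def partitionFunction {d : ℕ} (V : Site d → ℝ≥0∞) (α : ℝ) (Λ : Finset (Site d)) : ℝ≥0∞ :=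
  ∑' σ : PermIn Λ, boltzmann α (hamiltonian V Λ σ.1)

/-- The measure `G_Λ` on permutations: mass `exp (-α H_Λ σ) / Z_Λ` at each `σ ∈ S_Λ`. -/
def specMeasure {d : ℕ} (V : Site d → ℝ≥0∞) (α : ℝ) (Λ : Finset (Site d)) :
    Measure (Permutation d) :=
  Measure.sum fun σ : PermIn Λ =>
    (boltzmann α (hamiltonian V Λ σ.1) / partitionFunction V α Λ) • Measure.dirac σ.1

lemma boltzmann_le_one {α : ℝ} (hα : 0 < α) (E : ℝ≥0∞) : boltzmann α E ≤ 1 := by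
  rw [boltzmann, EReal.exp_le_one_iff, EReal.neg_le, neg_zero]
  exact mul_nonneg (by exact_mod_cast hα.le) (EReal.coe_ennreal_nonneg E)

instance permInFinite {d : ℕ} (Λ : Finset (Site d)) : Finite (PermIn Λ) := by
  classical
  exact Finite.of_equiv _ (Equiv.Perm.subtypeEquivSubtypePerm fun x : Site d => x ∈ Λ)

lemma specMeasure_isProbability {d : ℕ} {V : Site d → ℝ≥0∞} (hV : V 0 = 0) {α : ℝ} (hα : 0 < α)
    (Λ : Finset (Site d)) : IsProbabilityMeasure (specMeasure V α Λ) := by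
  classical
  have := Fintype.ofFinite (PermIn Λ)
  have h0 : partitionFunction V α Λ ≠ 0 := by
    have h1 : boltzmann α (hamiltonian V Λ (1 : Permutation d)) ≤ partitionFunction V α Λ :=
      ENNReal.le_tsum (f := fun σ : PermIn Λ => boltzmann α (hamiltonian V Λ σ.1))
        ⟨1, fun x _ => rfl⟩
    have h2 : boltzmann α (hamiltonian V Λ (1 : Permutation d)) = 1 := by
      simp [boltzmann, hamiltonian, hV]
    intro h
    rw [h2, h] at h1
    exact absurd h1 (by simp)
  have hT : partitionFunction V α Λ ≠ ∞ := by
    rw [partitionFunction, tsum_fintype]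
    exact ENNReal.sum_ne_top.2 fun σ _ => ((boltzmann_le_one hα _).trans_lt ENNReal.one_lt_top).ne
  constructor
  rw [specMeasure, Measure.sum_apply _ MeasurableSet.univ]
  simp only [Measure.smul_apply, measure_univ, smul_eq_mul, mul_one, div_eq_mul_inv]
  rw [ENNReal.tsum_mul_right]
  exact ENNReal.mul_inv_cancel h0 hT

/-- The specification `G_Λ` with identity boundary conditions, as a probability measure. -/
def specification {d : ℕ} (V : Site d → ℝ≥0∞) (hV : V 0 = 0) (α : ℝ) (hα : 0 < α)
    (Λ : Finset (Site d)) : ProbabilityMeasure (Permutation d) :=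
  ⟨specMeasure V α Λ, specMeasure_isProbability hV hα Λ⟩

/-! ### Poisson processes -/

/-- `N` is a Poisson point process with (diffuse, σ-finite) intensity measure `ν`, given by its
random set of points: the number of points in a set of finite intensity is Poisson, and the numbers
of points in disjoint sets are independent. -/
structure IsPoissonProcess {Ω E : Type*} [MeasurableSpace Ω] [MeasurableSpace E]
    (N : Ω → Set E) (ν : Measure E) (P : Measure Ω) : Prop where
  measurable_count : ∀ B : Set E, MeasurableSet B → Measurable fun ω => (N ω ∩ B).encard
  hasLaw_count : ∀ B : Set E, MeasurableSet B → ν B ≠ ∞ →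
    HasLaw (fun ω => (N ω ∩ B).encard)
      ((poissonMeasure (ν B).toNNReal).map (fun n : ℕ => (n : ℕ∞))) P
  indep_count : ∀ (n : ℕ) (B : Fin n → Set E), (∀ i, MeasurableSet (B i)) →
    Pairwise (fun i j => Disjoint (B i) (B j)) →
    iIndepFun (fun i ω => (N ω ∩ B i).encard) P

/-- Space-time points `(γ, t, s)`: the cycle `γ` attempts to be born at time `t`, to live for `s`
time units. -/
abbrev Point (d : ℕ) := FinCycle d × ℝ × ℝ≥0

/-- The intensity measure `w γ dt e^{-s} ds` on `Γ × ℝ × ℝ⁺`; here `e^{-s} ds` is the exponential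
law of rate `1`, carried over from `ℝ` to `ℝ⁺ = [0, ∞)`. -/
def intensity {d : ℕ} (V : Site d → ℝ≥0∞) (α : ℝ) : Measure (Point d) :=
  (Measure.count.withDensity (weight V α)).prod
    ((volume : Measure ℝ).prod ((expMeasure 1).map Real.toNNReal))

/-! ### The graphical construction, for a fixed realization `N` of the points -/

/-- The first generation of ancestors of `φ`. -/
def ancestors {d : ℕ} (N : Set (Point d)) (φ : Point d) : Set (Point d) :=
  {ψ ∈ N | Incompatible ψ.1 φ.1 ∧ ψ.2.1 < φ.2.1 ∧ φ.2.1 < ψ.2.1 + ψ.2.2}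

/-- `generation N φ n` is the `(n + 1)`-th generation of ancestors of `φ`. -/
def generation {d : ℕ} (N : Set (Point d)) (φ : Point d) : ℕ → Set (Point d)
  | 0 => ancestors N φ
  | n + 1 => ⋃ ψ ∈ generation N φ n, ancestors N ψ

/-- The clan of ancestors of `φ`. -/
def clan {d : ℕ} (N : Set (Point d)) (φ : Point d) : Set (Point d) :=
  ⋃ n, generation N φ n

/-- The points all of whose first ancestors lie in `D`. -/
def keptStep {d : ℕ} (N D : Set (Point d)) : Set (Point d) :=
  {φ ∈ N | ancestors N φ \ D = ∅}

/-- The points with a first ancestor in `K`. -/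
def deletedStep {d : ℕ} (N K : Set (Point d)) : Set (Point d) :=
  {φ ∈ N | (ancestors N φ ∩ K).Nonempty}

/-- The sets `D_n`: `D_0 = ∅` and `D_{n+1} = {φ ∈ N | A_1^φ ∩ K_{n+1} ≠ ∅}`, where
`K_{n+1} = {φ ∈ N | A_1^φ \ D_n = ∅}`. -/
def deleted {d : ℕ} (N : Set (Point d)) : ℕ → Set (Point d)
  | 0 => ∅
  | n + 1 => deletedStep N (keptStep N (deleted N n))

/-- The set `K = ⋃_{n ≥ 1} K_n` of kept points. -/
def kept {d : ℕ} (N : Set (Point d)) : Set (Point d) :=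
  ⋃ n, keptStep N (deleted N n)

/-- The loss network `η_t`: the number of kept points `(γ, t', s')` alive at time `t`, that is,
with `t' ≤ t < t' + s'`. (For almost every realization this is a finite set.) -/
def lossNetwork {d : ℕ} (N : Set (Point d)) (t : ℝ) : Config d := fun γ =>
  {φ ∈ kept N | φ.1 = γ ∧ φ.2.1 ≤ t ∧ t < φ.2.1 + φ.2.2}.ncard

/-- The points `N^Λ` whose cycles have support in `Λ`. -/
def restrictTo {d : ℕ} (N : Set (Point d)) (Λ : Set (Site d)) : Set (Point d) :=
  {φ ∈ N | (φ.1.support : Set (Site d)) ⊆ Λ}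

/-- The filter of `Λ ↗ ℤ^d` on arbitrary (finite or infinite) sets of sites: a property holds
eventually if it holds for all `Λ` that contain a certain finite set. -/
def exhaustion (d : ℕ) : Filter (Set (Site d)) :=
  ⨅ F : Finset (Site d), 𝓟 {Λ | (F : Set (Site d)) ⊆ Λ}

end CycleGas

end

open CycleGas

/-!
The proof rests on the reversibility of the loss network in a finite volume, for which the points of
the Poisson process are treated as one random finite set.

Let `Λ` be finite, `a < t`, and consider the points with cycles in `Λ` that are born before `t` and
die after `a`. There are finitely many of them, so the kept points are the unique kernel of the
ancestor relation: the set `K` without internal ancestors such that every other point has an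
ancestor in `K` (`kept_eq_of_kernel`). Given compatible gases `η` and `ζ`, the event that the gas
alive at time `a` is `η` and that the loss network at time `t` is `ζ` therefore says that some `K`
is ancestor-free, has the gases `η` at time `a` and `ζ` at time `t`, and that all other points are
born after `a` and blocked by `K` (`aliveCount_and_lossNetwork_iff`). Conditionally on their number,
the points are independent with a common law (`IsPoissonProcess.measure_inter_mem`). Reverse time on
the points of `K`, which exchanges births and deaths, and reflect the births of the others, keeping
their lifetimes. Both maps preserve the intensity, and together they exchange `η` and `ζ`. Hence the
probability of the event is symmetric in `η` and `ζ`
(`measure_aliveCount_and_lossNetwork_comm`).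

Now take `ζ = 0` and let `a → -∞`. The gas alive at time `a` is a family of independent Poisson
variables, independent of the points born after `a`, and by the finiteness of the clans it has no
influence on the loss network at time `t` in the limit. The symmetry becomes
`P (η_t^Λ = η) = (∏ γ, w γ ^ η γ) * P (η_t^Λ = 0)`, which identifies the law of `η_t^Λ` as `G_Λ`
(`measure_lossNetwork_restrictTo_eq`, `map_permOf_lossNetwork_restrictTo`).

Finally, whether a point is kept depends on its clan only, and finitely many points with a cycle
through a given site are alive at time `t`. So almost surely the cycles through each site in
`η_t^Λ` are those in `η_t`, once `Λ` is large (`exists_finset_lossNetwork_restrictTo_eq`). This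
gives the almost sure limit, and with it the weak limit of `G_Λ`; since `G_Λ` does not depend on
`t`, neither does the law of `η_t`.

The law of the process in a window is determined by its void probabilities: the events that there
are no points in a set form a π-system, and both the Poisson process and a Poisson number of
independent points have the same probabilities of these. That properties of the loss network are
events of the σ-algebra they generate follows by rounding births and deaths down to a grid, which
for a finite set of points eventually preserves all the order relations that matter
(`exists_measurableSet_of_stable`).
-/

namespace CycleGas

/-! ### The kept points as the kernel of the ancestor relation -/

section Kernel

variable {d : ℕ} {M N N' K : Set (Point d)} {φ ψ : Point d}

lemma ancestors_mono (h : N' ⊆ N) (φ : Point d) : ancestors N' φ ⊆ ancestors N φ :=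
  fun _ hψ => ⟨h hψ.1, hψ.2⟩

lemma generation_mono (h : N' ⊆ N) (φ : Point d) (n : ℕ) :
    generation N' φ n ⊆ generation N φ n := by
  induction n with
  | zero => exact ancestors_mono h φ
  | succ n ih => exact Set.biUnion_mono ih fun ψ _ => ancestors_mono h ψ

lemma clan_mono (h : N' ⊆ N) (φ : Point d) : clan N' φ ⊆ clan N φ :=
  Set.iUnion_mono fun n => generation_mono h φ n

lemma ancestors_subset_clan (N : Set (Point d)) (φ : Point d) : ancestors N φ ⊆ clan N φ :=
  Set.subset_iUnion (generation N φ) 0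

lemma clan_subset (N : Set (Point d)) (φ : Point d) : clan N φ ⊆ N := by
  refine Set.iUnion_subset fun n => ?_
  cases n with
  | zero => exact fun _ h => h.1
  | succ n => exact Set.iUnion₂_subset fun _ _ _ h => h.1

lemma clan_subset_clan (h : ψ ∈ ancestors N φ) : clan N ψ ⊆ clan N φ := by
  refine Set.iUnion_subset fun n => Set.Subset.trans ?_ (Set.subset_iUnion _ (n + 1))
  induction n with
  | zero => exact fun χ hχ => Set.mem_biUnion (x := ψ) h hχ
  | succ n ih => exact Set.biUnion_mono ih fun _ _ => subset_rfl

lemma birth_lt_of_mem_clan (h : ψ ∈ clan N φ) : ψ.2.1 < φ.2.1 := by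
  obtain ⟨n, hn⟩ := Set.mem_iUnion.1 h
  clear h
  induction n generalizing ψ with
  | zero => exact hn.2.2.1
  | succ n ih =>
    obtain ⟨χ, hχ, h⟩ := Set.mem_iUnion₂.1 hn
    exact h.2.2.1.trans (ih hχ)

/-- Induction along the ancestor relation, which is well-founded below a finite clan. -/
lemma clan_induction {p : Point d → Prop} (hp : ∀ φ, (∀ ψ ∈ ancestors N φ, p ψ) → p φ)
    (hφ : (clan N φ).Finite) : p φ := by
  induction h : (clan N φ).ncard using Nat.strong_induction_on generalizing φ with
  | _ n ih =>
    refine hp φ fun ψ hψ => ?_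
    have hsub : clan N ψ ⊂ clan N φ :=
      ⟨clan_subset_clan hψ, fun hs => lt_irrefl _
        (birth_lt_of_mem_clan (hs (ancestors_subset_clan N φ hψ)))⟩
    exact ih _ (h ▸ Set.ncard_lt_ncard hsub hφ) (hφ.subset hsub.1) rfl

lemma deleted_mono (N : Set (Point d)) : Monotone (deleted N) := by
  refine monotone_nat_of_le_succ fun n => ?_
  induction n with
  | zero => exact Set.empty_subset _
  | succ n ih =>
    rintro φ ⟨hφ, ψ, hψ, hψN, hψK⟩
    refine ⟨hφ, ψ, hψ, hψN, ?_⟩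
    exact Set.subset_empty_iff.1 fun χ hχ => hψK.subset ⟨hχ.1, fun h => hχ.2 (ih h)⟩

lemma notMem_deleted_of_mem_keptStep (m n : ℕ) (hK : φ ∈ keptStep N (deleted N n)) :
    φ ∉ deleted N m := by
  induction h : m + n using Nat.strong_induction_on generalizing m n φ with
  | _ k ih =>
    intro hD
    cases m with
    | zero => exact hD
    | succ m =>
      obtain ⟨-, ψ, hψ, hψK⟩ := hD
      have hψD : ψ ∈ deleted N n := by
        by_contra hc
        exact hK.2.subset ⟨hψ, hc⟩
      exact ih (n + m) (by omega) n m hψK rfl hψD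

lemma mem_kept_or_mem_deleted (hN : φ ∈ N) (hφ : (clan N φ).Finite) :
    φ ∈ kept N ∨ ∃ n, φ ∈ deleted N n := by
  revert hN
  have hfin := hφ
  refine clan_induction (p := fun φ => (clan N φ).Finite → φ ∈ N →
    φ ∈ kept N ∨ ∃ n, φ ∈ deleted N n) (fun φ ih hc hN => ?_) hφ hfin
  have ih' : ∀ ψ ∈ ancestors N φ, ψ ∈ kept N ∨ ∃ n, ψ ∈ deleted N n := fun ψ hψ =>
    ih ψ hψ (hc.subset (clan_subset_clan hψ)) hψ.1
  by_cases hk : ∃ ψ ∈ ancestors N φ, ψ ∈ kept N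
  · obtain ⟨ψ, hψ, hψK⟩ := hk
    obtain ⟨n, hn⟩ := Set.mem_iUnion.1 hψK
    exact Or.inr ⟨n + 1, hN, ψ, hψ, hn⟩
  · push Not at hk
    have hD : ∀ ψ ∈ ancestors N φ, ∃ n, ψ ∈ deleted N n := fun ψ hψ =>
      (ih' ψ hψ).resolve_left (hk ψ hψ)
    choose! n hn using hD
    have hanc : (ancestors N φ).Finite := hc.subset (ancestors_subset_clan N φ)
    obtain ⟨b, hb⟩ := (hanc.image n).bddAbove
    refine Or.inl (Set.mem_iUnion.2 ⟨b, hN, Set.subset_empty_iff.1 fun ψ hψ => hψ.2 ?_⟩)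
    exact deleted_mono N (hb ⟨ψ, hψ.1, rfl⟩) (hn ψ hψ.1)

lemma kept_subset (N : Set (Point d)) : kept N ⊆ N :=
  Set.iUnion_subset fun _ _ h => h.1

/-- A point with a finite clan is kept if and only if it has no kept ancestor. -/
lemma mem_kept_iff (hφ : (clan N φ).Finite) :
    φ ∈ kept N ↔ φ ∈ N ∧ ∀ ψ ∈ ancestors N φ, ψ ∉ kept N := by
  constructor
  · intro h
    refine ⟨kept_subset N h, fun ψ hψ hψK => ?_⟩
    obtain ⟨n, hn⟩ := Set.mem_iUnion.1 h
    obtain ⟨m, hm⟩ := Set.mem_iUnion.1 hψK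
    exact notMem_deleted_of_mem_keptStep (m + 1) n hn ⟨hn.1, ψ, hψ, hm⟩
  · rintro ⟨hN, h⟩
    refine (mem_kept_or_mem_deleted hN hφ).resolve_right ?_
    rintro ⟨n, hn⟩
    cases n with
    | zero => exact hn
    | succ n =>
      obtain ⟨-, ψ, hψ, hψK⟩ := hn
      exact h ψ hψ (Set.mem_iUnion.2 ⟨n, hψK⟩)

/-- Whether a point is kept depends on its clan only. -/
lemma mem_kept_iff_of_clan_subset (h : N' ⊆ N) (hφN : φ ∈ N') (hfin : (clan N φ).Finite)
    (hφ : clan N φ ⊆ N') : φ ∈ kept N' ↔ φ ∈ kept N := by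
  refine clan_induction (N := N) (p := fun φ => (clan N φ).Finite → φ ∈ N' → clan N φ ⊆ N' →
    (φ ∈ kept N' ↔ φ ∈ kept N)) (fun φ ih hfin hφN hφ => ?_) hfin hfin hφN hφ
  have ha : ancestors N' φ = ancestors N φ := (ancestors_mono h φ).antisymm fun ψ hψ =>
    ⟨hφ (ancestors_subset_clan N φ hψ), hψ.2⟩
  rw [mem_kept_iff hfin, mem_kept_iff (hfin.subset (clan_mono h φ)), ha]
  refine and_congr (iff_of_true hφN (h hφN)) (forall₂_congr fun ψ hψ => not_congr ?_)
  exact ih ψ hψ (hfin.subset (clan_subset_clan hψ))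
    (hφ (ancestors_subset_clan N φ hψ)) ((clan_subset_clan hψ).trans hφ)

/-- The set of kept points is the only kernel of the ancestor relation: it has no internal
ancestors, and every other point has an ancestor in it. -/
lemma kept_eq_of_kernel (hfin : M.Finite) (hKM : K ⊆ M) (hK : ∀ φ ∈ K, ancestors K φ = ∅)
    (hD : ∀ φ ∈ M \ K, (ancestors K φ).Nonempty) : kept M = K := by
  have hc : ∀ φ, (clan M φ).Finite := fun φ => hfin.subset (clan_subset M φ)
  have key : ∀ φ, φ ∈ M → (φ ∈ kept M ↔ φ ∈ K) := fun φ => by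
    refine clan_induction (N := M) (p := fun φ => φ ∈ M → (φ ∈ kept M ↔ φ ∈ K))
      (fun φ ih hφ => ?_) (hc φ)
    rw [mem_kept_iff (hc φ)]
    constructor
    · rintro ⟨-, h⟩
      by_contra hφK
      obtain ⟨ψ, hψ⟩ := hD φ ⟨hφ, hφK⟩
      exact h ψ (ancestors_mono hKM φ hψ) ((ih ψ (ancestors_mono hKM φ hψ) (hKM hψ.1)).2 hψ.1)
    · refine fun hφK => ⟨hφ, fun ψ hψ hψk => ?_⟩
      exact (hK φ hφK).subset ⟨(ih ψ hψ hψ.1).1 hψk, hψ.2⟩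
  ext φ
  exact ⟨fun h => (key φ (kept_subset M h)).1 h, fun h => (key φ (hKM h)).2 h⟩

lemma ancestors_kept_eq_empty (hfin : M.Finite) (hφ : φ ∈ kept M) : ancestors (kept M) φ = ∅ := by
  refine Set.subset_empty_iff.1 fun ψ hψ => ?_
  exact ((mem_kept_iff (hfin.subset (clan_subset M φ))).1 hφ).2 ψ
    (ancestors_mono (kept_subset M) φ hψ) hψ.1

lemma ancestors_kept_nonempty (hfin : M.Finite) (hφ : φ ∈ M \ kept M) :
    (ancestors (kept M) φ).Nonempty := by
  have h := hφ.2
  rw [mem_kept_iff (hfin.subset (clan_subset M φ))] at h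
  push Not at h
  obtain ⟨ψ, hψ, hψK⟩ := h hφ.1
  exact ⟨ψ, hψK, hψ.2⟩

/-- The gas of the points of `M` that are alive at time `t`. -/
noncomputable def aliveCount (M : Set (Point d)) (t : ℝ) : Config d := fun γ =>
  {φ ∈ M | φ.1 = γ ∧ φ.2.1 ≤ t ∧ t < φ.2.1 + φ.2.2}.ncard

lemma lossNetwork_eq_aliveCount (M : Set (Point d)) (t : ℝ) :
    lossNetwork M t = aliveCount (kept M) t := rfl

end Kernel

/-! ### Order-preserving maps of points and discretization -/

section Discretization

variable {d : ℕ}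

/-- The map `f` preserves, for the points of `M`, the cycles and the order of all births and
deaths. -/
structure PreservesOrder (f : Point d → Point d) (M : Set (Point d)) : Prop where
  injOn : Set.InjOn f M
  cycle : ∀ φ ∈ M, (f φ).1 = φ.1
  birth_lt : ∀ φ ∈ M, ∀ ψ ∈ M, (f ψ).2.1 < (f φ).2.1 ↔ ψ.2.1 < φ.2.1
  lt_death : ∀ φ ∈ M, ∀ ψ ∈ M,
    (f φ).2.1 < (f ψ).2.1 + (f ψ).2.2 ↔ φ.2.1 < ψ.2.1 + ψ.2.2

lemma PreservesOrder.mono {f : Point d → Point d} {M K : Set (Point d)} (h : PreservesOrder f M)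
    (hK : K ⊆ M) : PreservesOrder f K where
  injOn := h.injOn.mono hK
  cycle φ hφ := h.cycle φ (hK hφ)
  birth_lt φ hφ ψ hψ := h.birth_lt φ (hK hφ) ψ (hK hψ)
  lt_death φ hφ ψ hψ := h.lt_death φ (hK hφ) ψ (hK hψ)

lemma PreservesOrder.ancestors_image {f : Point d → Point d} {M K : Set (Point d)}
    (h : PreservesOrder f M) (hK : K ⊆ M) {φ : Point d} (hφ : φ ∈ M) :
    ancestors (f '' K) (f φ) = f '' ancestors K φ := by
  ext χ
  constructor
  · rintro ⟨⟨ψ, hψ, rfl⟩, h1, h2, h3⟩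
    rw [h.cycle ψ (hK hψ), h.cycle φ hφ] at h1
    exact ⟨ψ, ⟨hψ, h1, (h.birth_lt φ hφ ψ (hK hψ)).1 h2, (h.lt_death φ hφ ψ (hK hψ)).1 h3⟩, rfl⟩
  · rintro ⟨ψ, ⟨hψ, h1, h2, h3⟩, rfl⟩
    refine ⟨⟨ψ, hψ, rfl⟩, ?_, (h.birth_lt φ hφ ψ (hK hψ)).2 h2,
      (h.lt_death φ hφ ψ (hK hψ)).2 h3⟩
    rwa [h.cycle ψ (hK hψ), h.cycle φ hφ]

lemma PreservesOrder.kept_image {f : Point d → Point d} {M : Set (Point d)}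
    (h : PreservesOrder f M) (hM : M.Finite) : kept (f '' M) = f '' kept M := by
  have hs := kept_subset M
  refine kept_eq_of_kernel (hM.image f) (Set.image_mono hs) ?_ ?_
  · rintro _ ⟨φ, hφ, rfl⟩
    rw [h.ancestors_image hs (hs hφ), ancestors_kept_eq_empty hM hφ, Set.image_empty]
  · rintro _ ⟨⟨φ, hφ, rfl⟩, hn⟩
    rw [h.ancestors_image hs hφ]
    exact (ancestors_kept_nonempty hM ⟨hφ, fun hk => hn ⟨φ, hk, rfl⟩⟩).image f

/-- The map `f` preserves being alive at time `c`, for the points of `M`. -/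
def PreservesAlive (f : Point d → Point d) (M : Set (Point d)) (c : ℝ) : Prop :=
  ∀ φ ∈ M, ((f φ).2.1 ≤ c ∧ c < (f φ).2.1 + (f φ).2.2) ↔ (φ.2.1 ≤ c ∧ c < φ.2.1 + φ.2.2)

lemma PreservesOrder.aliveCount_image {f : Point d → Point d} {M : Set (Point d)} {c : ℝ}
    (h : PreservesOrder f M) (hc : PreservesAlive f M c) :
    aliveCount (f '' M) c = aliveCount M c := by
  funext γ
  have he : {φ ∈ f '' M | φ.1 = γ ∧ φ.2.1 ≤ c ∧ c < φ.2.1 + φ.2.2} =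
      f '' {φ ∈ M | φ.1 = γ ∧ φ.2.1 ≤ c ∧ c < φ.2.1 + φ.2.2} := by
    ext χ
    constructor
    · rintro ⟨⟨φ, hφ, rfl⟩, h1, h2⟩
      exact ⟨φ, ⟨hφ, (h.cycle φ hφ) ▸ h1, (hc φ hφ).1 h2⟩, rfl⟩
    · rintro ⟨φ, ⟨hφ, h1, h2⟩, rfl⟩
      exact ⟨⟨φ, hφ, rfl⟩, (h.cycle φ hφ).trans h1, (hc φ hφ).2 h2⟩
  rw [aliveCount, aliveCount, he]
  exact (h.injOn.mono fun φ hφ => hφ.1).ncard_image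

/-- Rounding births and deaths down to multiples of `1 / (m + 1)`. For
given reals `x`, `y` and `c`, rounding `x` and `y` on a fine enough grid does not change whether
`x < y` or whether `c < x`; it can change whether `x < c`. The lifetime is the difference of the
rounded death and birth; it is not negative, so that `Real.toNNReal` does not truncate. -/
noncomputable def discretize (m : ℕ) (φ : Point d) : Point d :=
  (φ.1, ⌊(m + 1) * φ.2.1⌋ / (m + 1),
    Real.toNNReal ((⌊(m + 1) * (φ.2.1 + φ.2.2)⌋ - ⌊(m + 1) * φ.2.1⌋ : ℤ) / (m + 1)))

lemma discretize_death (m : ℕ) (φ : Point d) :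
    (discretize m φ).2.1 + (discretize m φ).2.2 = ⌊(m + 1) * (φ.2.1 + φ.2.2)⌋ / (m + 1) := by
  have hm : (0 : ℝ) < m + 1 := by positivity
  have h : (⌊(m + 1) * φ.2.1⌋ : ℤ) ≤ ⌊(m + 1) * (φ.2.1 + φ.2.2)⌋ := by
    refine Int.floor_le_floor ?_
    have : (0 : ℝ) ≤ φ.2.2 := φ.2.2.2
    gcongr
    linarith
  have h0 : (0 : ℝ) ≤ ((⌊(m + 1) * (φ.2.1 + φ.2.2)⌋ - ⌊(m + 1) * φ.2.1⌋ : ℤ) : ℝ) / (m + 1) := by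
    refine div_nonneg ?_ hm.le
    exact_mod_cast sub_nonneg.2 h
  simp only [discretize]
  rw [Real.coe_toNNReal _ h0]
  push_cast
  ring

lemma measurable_discretize (m : ℕ) : Measurable (discretize (d := d) m) := by
  unfold discretize
  fun_prop

lemma countable_range_discretize (m : ℕ) : (Set.range (discretize (d := d) m)).Countable := by
  have : Set.range (discretize (d := d) m) ⊆ Set.range fun p : FinCycle d × ℤ × ℤ =>
      ((p.1, (p.2.1 : ℝ) / (m + 1), Real.toNNReal ((p.2.2 - p.2.1 : ℤ) / (m + 1))) : Point d) := by
    rintro _ ⟨φ, rfl⟩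
    exact ⟨(φ.1, ⌊(m + 1) * φ.2.1⌋, ⌊(m + 1) * (φ.2.1 + φ.2.2)⌋), rfl⟩
  exact (Set.countable_range _).mono this

lemma eventually_floor_lt_iff (x y : ℝ) :
    ∀ᶠ m : ℕ in atTop, ((⌊(m + 1) * x⌋ : ℝ) / (m + 1) < ⌊(m + 1) * y⌋ / (m + 1) ↔ x < y) := by
  rcases lt_or_ge x y with h | h
  · obtain ⟨k, hk⟩ := exists_nat_gt (1 / (y - x))
    filter_upwards [eventually_ge_atTop k] with m hm
    refine iff_of_true ?_ h
    have hm0 : (0 : ℝ) < m + 1 := by positivity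
    have h1 : 1 < (m + 1) * (y - x) := by
      rw [div_lt_iff₀ (sub_pos.2 h)] at hk
      have : (k : ℝ) ≤ m + 1 := by exact_mod_cast hm.trans m.le_succ
      exact hk.trans_le (mul_le_mul_of_nonneg_right this (sub_pos.2 h).le)
    have h2 := Int.floor_le ((m + 1) * x)
    have h3 := Int.sub_one_lt_floor ((m + 1) * y)
    refine div_lt_div_of_pos_right ?_ hm0
    linarith
  · refine Eventually.of_forall fun m => iff_of_false (not_lt.2 ?_) (not_lt.2 h)
    gcongr

lemma eventually_lt_floor_iff (c x : ℝ) :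
    ∀ᶠ m : ℕ in atTop, (c < (⌊(m + 1) * x⌋ : ℝ) / (m + 1) ↔ c < x) := by
  rcases lt_or_ge c x with h | h
  · obtain ⟨k, hk⟩ := exists_nat_gt (1 / (x - c))
    filter_upwards [eventually_ge_atTop k] with m hm
    refine iff_of_true ?_ h
    have hm0 : (0 : ℝ) < m + 1 := by positivity
    have h1 : 1 < (m + 1) * (x - c) := by
      rw [div_lt_iff₀ (sub_pos.2 h)] at hk
      have : (k : ℝ) ≤ m + 1 := by exact_mod_cast hm.trans m.le_succ
      exact hk.trans_le (mul_le_mul_of_nonneg_right this (sub_pos.2 h).le)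
    have h3 := Int.sub_one_lt_floor ((m + 1) * x)
    rw [lt_div_iff₀ hm0]
    linarith
  · refine Eventually.of_forall fun m => iff_of_false (not_lt.2 ?_) (not_lt.2 h)
    rw [div_le_iff₀ (by positivity)]
    have := Int.floor_le ((m + 1) * x)
    nlinarith [(by positivity : (0 : ℝ) < m + 1)]

lemma eventually_preservesOrder {M : Set (Point d)} (hM : M.Finite) :
    ∀ᶠ m in atTop, PreservesOrder (discretize m) M := by
  have h1 : ∀ᶠ m : ℕ in atTop, ∀ φ ∈ M, ∀ ψ ∈ M,
      ((discretize m ψ).2.1 < (discretize m φ).2.1 ↔ ψ.2.1 < φ.2.1) := by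
    rw [eventually_all_finite hM]
    refine fun φ _ => (eventually_all_finite hM).2 fun ψ _ => ?_
    exact eventually_floor_lt_iff ψ.2.1 φ.2.1
  have h2 : ∀ᶠ m : ℕ in atTop, ∀ φ ∈ M, ∀ ψ ∈ M,
      ((discretize m φ).2.1 < (discretize m ψ).2.1 + (discretize m ψ).2.2 ↔
        φ.2.1 < ψ.2.1 + ψ.2.2) := by
    rw [eventually_all_finite hM]
    refine fun φ _ => (eventually_all_finite hM).2 fun ψ _ => ?_
    simp only [discretize_death]
    exact eventually_floor_lt_iff φ.2.1 (ψ.2.1 + ψ.2.2)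
  have h3 : ∀ᶠ m : ℕ in atTop, ∀ φ ∈ M, ∀ ψ ∈ M,
      ((discretize m φ).2.1 + (discretize m φ).2.2 < (discretize m ψ).2.1 + (discretize m ψ).2.2 ↔
        φ.2.1 + φ.2.2 < ψ.2.1 + ψ.2.2) := by
    rw [eventually_all_finite hM]
    refine fun φ _ => (eventually_all_finite hM).2 fun ψ _ => ?_
    simp only [discretize_death]
    exact eventually_floor_lt_iff (φ.2.1 + φ.2.2) (ψ.2.1 + ψ.2.2)
  filter_upwards [h1, h2, h3] with m h1 h2 h3
  refine ⟨fun φ hφ ψ hψ h => ?_, fun _ _ => rfl, h1, h2⟩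
  have hb : φ.2.1 = ψ.2.1 := by
    refine le_antisymm (not_lt.1 fun hl => ?_) (not_lt.1 fun hl => ?_)
    · exact absurd ((h1 φ hφ ψ hψ).2 hl) (by rw [h]; exact lt_irrefl _)
    · exact absurd ((h1 ψ hψ φ hφ).2 hl) (by rw [h]; exact lt_irrefl _)
  have he : φ.2.1 + φ.2.2 = ψ.2.1 + ψ.2.2 := by
    refine le_antisymm (not_lt.1 fun hl => ?_) (not_lt.1 fun hl => ?_)
    · exact absurd ((h3 ψ hψ φ hφ).2 hl) (by rw [h]; exact lt_irrefl _)
    · exact absurd ((h3 φ hφ ψ hψ).2 hl) (by rw [h]; exact lt_irrefl _)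
  have hc : (discretize m φ).1 = (discretize m ψ).1 := congrArg Prod.fst h
  refine Prod.ext hc (Prod.ext hb (NNReal.coe_injective ?_))
  linarith

lemma eventually_preservesAlive {M : Set (Point d)} (hM : M.Finite) (c : ℝ) :
    ∀ᶠ m in atTop, PreservesAlive (discretize m) M c := by
  unfold PreservesAlive
  rw [eventually_all_finite hM]
  intro φ _
  simp only [discretize_death]
  filter_upwards [eventually_lt_floor_iff c φ.2.1, eventually_lt_floor_iff c (φ.2.1 + φ.2.2)]
    with m h1 h2
  rw [← not_lt, ← not_lt, h2]
  exact and_congr_left fun _ => not_congr h1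

/-- A property of finite sets of points that does not change when births and deaths are rounded
down to a fine enough grid. Such properties are events; see `exists_measurableSet_of_stable`. -/
def Stable (Φ : Set (Point d) → Prop) : Prop :=
  ∀ M : Set (Point d), M.Finite → ∀ᶠ m in atTop, (Φ (discretize m '' M) ↔ Φ M)

lemma Stable.and {Φ Ψ : Set (Point d) → Prop} (hΦ : Stable Φ) (hΨ : Stable Ψ) :
    Stable fun M => Φ M ∧ Ψ M := fun M hM => by
  filter_upwards [hΦ M hM, hΨ M hM] with m h1 h2
  rw [h1, h2]

lemma stable_aliveCount (c : ℝ) (p : Config d → Prop) : Stable fun M => p (aliveCount M c) :=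
  fun M hM => by
    filter_upwards [eventually_preservesOrder hM, eventually_preservesAlive hM c] with m h1 h2
    rw [h1.aliveCount_image h2]

lemma stable_lossNetwork (c : ℝ) (p : Config d → Prop) : Stable fun M => p (lossNetwork M c) :=
  fun M hM => by
    filter_upwards [eventually_preservesOrder hM, eventually_preservesAlive hM c] with m h1 h2
    rw [lossNetwork_eq_aliveCount, h1.kept_image hM, (h1.mono (kept_subset M)).aliveCount_image
      fun φ hφ => h2 φ (kept_subset M hφ)]
    rfl

/-- No point of `M` has an ancestor in `M`. -/
def AncestorFree (M : Set (Point d)) : Prop := ∀ φ ∈ M, ancestors M φ = ∅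

lemma stable_ancestorFree : Stable (AncestorFree (d := d)) := fun M hM => by
  filter_upwards [eventually_preservesOrder hM] with m h
  simp only [AncestorFree, Set.forall_mem_image]
  refine forall₂_congr fun φ hφ => ?_
  rw [h.ancestors_image subset_rfl hφ, Set.image_eq_empty]

/-- Two different points of `M` are born at the same time. -/
def HasSimultaneousBirths (M : Set (Point d)) : Prop := ∃ φ ∈ M, ∃ ψ ∈ M, φ ≠ ψ ∧ φ.2.1 = ψ.2.1

lemma stable_hasSimultaneousBirths : Stable (HasSimultaneousBirths (d := d)) := fun M hM => by
  filter_upwards [eventually_preservesOrder hM] with m h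
  simp only [HasSimultaneousBirths, Set.exists_mem_image]
  refine exists_congr fun φ => and_congr_right fun hφ => exists_congr fun ψ =>
    and_congr_right fun hψ => and_congr (h.injOn.ne_iff hφ hψ) ?_
  have h1 := h.birth_lt φ hφ ψ hψ
  have h2 := h.birth_lt ψ hψ φ hφ
  rw [le_antisymm_iff, le_antisymm_iff, ← not_lt, ← not_lt, ← not_lt, ← not_lt, h1, h2]

end Discretization

end CycleGas

namespace CycleGas

/-! ### Void events determine the law of a Poisson process -/

section Void

variable {E Ω : Type*}

/-- A set of points of `E`. The type is a copy of `Set E`, because it is to carry the σ-algebra of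
void events rather than the product one. -/
structure PointSet (E : Type*) where
  /-- The copy of a set of points in `PointSet E`. -/
  ofSet ::
  /-- The underlying set. -/
  toSet : Set E

/-- The event that there are no points in `B`. -/
def voidEvent (B : Set E) : Set (PointSet E) := {M | Disjoint M.toSet B}

/-- The σ-algebra on sets of points that is generated by the events that a given measurable set
contains no points. -/
instance pointSetMeasurableSpace [MeasurableSpace E] : MeasurableSpace (PointSet E) :=
  MeasurableSpace.generateFrom {U | ∃ B, MeasurableSet B ∧ U = voidEvent B}

lemma isPiSystem_voidEvent [MeasurableSpace E] :
    IsPiSystem {U : Set (PointSet E) | ∃ B, MeasurableSet B ∧ U = voidEvent B} := by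
  rintro _ ⟨B, hB, rfl⟩ _ ⟨B', hB', rfl⟩ -
  refine ⟨B ∪ B', hB.union hB', ?_⟩
  ext M
  exact (Set.disjoint_union_right (s := M.toSet)).symm

lemma measurableSet_voidEvent [MeasurableSpace E] {B : Set E} (hB : MeasurableSet B) :
    MeasurableSet (voidEvent B) :=
  MeasurableSpace.measurableSet_generateFrom ⟨B, hB, rfl⟩

lemma measurable_toPointSet [MeasurableSpace E] [MeasurableSpace Ω] {f : Ω → PointSet E}
    (h : ∀ B, MeasurableSet B → MeasurableSet {ω | Disjoint (f ω).toSet B}) : Measurable f :=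
  measurable_generateFrom fun _ ⟨B, hB, hU⟩ => by rw [hU]; exact h B hB

/-- The points `x i`, `i ∈ S`. -/
lemma measurable_image_toPointSet [MeasurableSpace E] {n : ℕ} (S : Finset (Fin n)) :
    Measurable fun x : Fin n → E => PointSet.ofSet (x '' S) := by
  refine measurable_toPointSet fun B hB => ?_
  have : {x : Fin n → E | Disjoint (x '' (S : Set (Fin n))) B} =
      ⋂ i ∈ S, {x : Fin n → E | x i ∈ Bᶜ} := by
    ext x
    simp [Set.disjoint_left]
  exact this ▸ Finset.measurableSet_biInter _ fun i _ => measurable_pi_apply i hB.compl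

lemma measurable_range_toPointSet [MeasurableSpace E] {n : ℕ} :
    Measurable fun x : Fin n → E => PointSet.ofSet (Set.range x) := by
  simpa using measurable_image_toPointSet (E := E) (Finset.univ : Finset (Fin n))

variable [MeasurableSpace E] [MeasurableSpace Ω] {N : Ω → Set E} {ν : Measure E} {P : Measure Ω}

lemma IsPoissonProcess.measurable_inter (hN : IsPoissonProcess N ν P) {R : Set E}
    (hR : MeasurableSet R) : Measurable fun ω => PointSet.ofSet (N ω ∩ R) := by
  refine measurable_toPointSet fun B hB => ?_
  have : {ω | Disjoint (N ω ∩ R) B} = (fun ω => (N ω ∩ (R ∩ B)).encard) ⁻¹' {0} := by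
    ext ω
    simp [Set.disjoint_iff_inter_eq_empty, Set.inter_assoc]
  exact this ▸ hN.measurable_count _ (hR.inter hB) (measurableSet_singleton 0)

lemma IsPoissonProcess.measure_encard_eq (hN : IsPoissonProcess N ν P) {B : Set E}
    (hB : MeasurableSet B) (hfin : ν B ≠ ∞) (n : ℕ) :
    P {ω | (N ω ∩ B).encard = n} =
      ENNReal.ofReal (Real.exp (-(ν B).toReal) * (ν B).toReal ^ n / n.factorial) := by
  have h1 : P {ω | (N ω ∩ B).encard = n} = P.map (fun ω => (N ω ∩ B).encard) {(n : ℕ∞)} := by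
    rw [Measure.map_apply (hN.measurable_count B hB) (measurableSet_singleton _)]
    rfl
  rw [h1, (hN.hasLaw_count B hB hfin).map_eq, Measure.map_apply (measurable_of_countable _)
    (measurableSet_singleton _)]
  have h2 : (fun k : ℕ => (k : ℕ∞)) ⁻¹' {(n : ℕ∞)} = {n} := by
    ext k
    simp
  rw [h2, poissonMeasure_singleton]
  rfl

lemma IsPoissonProcess.measure_disjoint (hN : IsPoissonProcess N ν P) {B : Set E}
    (hB : MeasurableSet B) (hfin : ν B ≠ ∞) :
    P {ω | Disjoint (N ω) B} = ENNReal.ofReal (Real.exp (-(ν B).toReal)) := by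
  have h := hN.measure_encard_eq hB hfin 0
  simpa [Set.disjoint_iff_inter_eq_empty] using h

lemma IsPoissonProcess.ae_finite_inter (hN : IsPoissonProcess N ν P) {B : Set E}
    (hB : MeasurableSet B) (hfin : ν B ≠ ∞) : ∀ᵐ ω ∂P, (N ω ∩ B).Finite := by
  have h1 : P {ω | (N ω ∩ B).encard = ⊤} = 0 := by
    have h1 : P {ω | (N ω ∩ B).encard = ⊤} = P.map (fun ω => (N ω ∩ B).encard) {⊤} := by
      rw [Measure.map_apply (hN.measurable_count B hB) (measurableSet_singleton _)]
      rfl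
    rw [h1, (hN.hasLaw_count B hB hfin).map_eq, Measure.map_apply (measurable_of_countable _)
      (measurableSet_singleton _)]
    have h2 : (fun k : ℕ => (k : ℕ∞)) ⁻¹' {⊤} = ∅ := by
      ext k
      simp
    rw [h2, measure_empty]
  filter_upwards [measure_eq_zero_iff_ae_notMem.1 h1] with ω hω
  exact Set.encard_ne_top_iff.1 hω

lemma IsPoissonProcess.ae_disjoint (hN : IsPoissonProcess N ν P) {B : Set E}
    (hB : MeasurableSet B) (h0 : ν B = 0) : ∀ᵐ ω ∂P, Disjoint (N ω) B := by
  have h1 : P {ω | (N ω ∩ B).encard ≠ 0} = 0 := by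
    have h1 : P {ω | (N ω ∩ B).encard ≠ 0} = P.map (fun ω => (N ω ∩ B).encard) {0}ᶜ := by
      rw [Measure.map_apply (hN.measurable_count B hB) (measurableSet_singleton _).compl]
      rfl
    rw [h1, (hN.hasLaw_count B hB (by simp [h0])).map_eq,
      Measure.map_apply (measurable_of_countable _) (measurableSet_singleton _).compl, h0]
    have h2 : (fun k : ℕ => (k : ℕ∞)) ⁻¹' {0}ᶜ = {0}ᶜ := by
      ext k
      simp
    rw [h2, prob_compl_eq_zero_iff (measurableSet_singleton _), poissonMeasure_singleton]
    simp
  filter_upwards [measure_eq_zero_iff_ae_notMem.1 h1] with ω hω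
  simpa [Set.disjoint_iff_inter_eq_empty] using hω

lemma tsum_inv_factorial_mul_pow {r : ℝ} (hr : 0 ≤ r) :
    ∑' n : ℕ, (n.factorial : ℝ≥0∞)⁻¹ * ENNReal.ofReal r ^ n = ENNReal.ofReal (Real.exp r) := by
  rw [Real.exp_eq_exp_ℝ, NormedSpace.exp_eq_tsum_div, ENNReal.ofReal_tsum_of_nonneg
    (fun n => by positivity) (Real.summable_pow_div_factorial r)]
  refine tsum_congr fun n => ?_
  rw [ENNReal.ofReal_div_of_pos (by positivity), ENNReal.ofReal_pow hr, ENNReal.ofReal_natCast,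
    mul_comm, div_eq_mul_inv]

/-- In a set `R` of finite intensity, a Poisson process is a Poisson number of independent points.
Both sides are probability measures on sets of points, so it is enough to compare void events. -/
theorem IsPoissonProcess.measure_inter_mem [IsProbabilityMeasure P] (hN : IsPoissonProcess N ν P)
    {R : Set E} (hR : MeasurableSet R) (hfin : ν R ≠ ∞) {U : Set (PointSet E)}
    (hU : MeasurableSet U) :
    P {ω | PointSet.ofSet (N ω ∩ R) ∈ U} = ∑' n : ℕ, ENNReal.ofReal (Real.exp (-(ν R).toReal)) *
      (n.factorial : ℝ≥0∞)⁻¹ *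
      Measure.pi (fun _ : Fin n => ν.restrict R) {x | PointSet.ofSet (Set.range x) ∈ U} := by
  have : Fact (ν R < ∞) := ⟨hfin.lt_top⟩
  let m₁ : Measure (PointSet E) := P.map fun ω => PointSet.ofSet (N ω ∩ R)
  let m₂ : Measure (PointSet E) := Measure.sum fun n : ℕ =>
    (ENNReal.ofReal (Real.exp (-(ν R).toReal)) * (n.factorial : ℝ≥0∞)⁻¹) •
      (Measure.pi (fun _ : Fin n => ν.restrict R)).map fun x => PointSet.ofSet (Set.range x)
  have h₁ : ∀ U, MeasurableSet U → m₁ U = P {ω | PointSet.ofSet (N ω ∩ R) ∈ U} := fun U hU =>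
    Measure.map_apply (hN.measurable_inter hR) hU
  have h₂ : ∀ U, MeasurableSet U → m₂ U = ∑' n : ℕ, ENNReal.ofReal (Real.exp (-(ν R).toReal)) *
      (n.factorial : ℝ≥0∞)⁻¹ *
      Measure.pi (fun _ : Fin n => ν.restrict R) {x | PointSet.ofSet (Set.range x) ∈ U} := by
    intro U hU
    rw [Measure.sum_apply _ hU]
    refine tsum_congr fun n => ?_
    rw [Measure.smul_apply, Measure.map_apply measurable_range_toPointSet hU, smul_eq_mul]
    rfl
  have key : ∀ B, MeasurableSet B → m₁ (voidEvent B) = m₂ (voidEvent B) := by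
    intro B hB
    rw [h₁ _ (measurableSet_voidEvent hB), h₂ _ (measurableSet_voidEvent hB)]
    have hfin' : ν (R ∩ B) ≠ ∞ := ne_top_of_le_ne_top hfin (measure_mono Set.inter_subset_left)
    have hfin'' : ν (R \ B) ≠ ∞ := ne_top_of_le_ne_top hfin (measure_mono Set.sdiff_subset)
    have e1 : {ω | PointSet.ofSet (N ω ∩ R) ∈ voidEvent B} = {ω | Disjoint (N ω) (R ∩ B)} := by
      ext ω
      simp [voidEvent, Set.disjoint_iff_inter_eq_empty, Set.inter_assoc]
    have e2 : ∀ n : ℕ, Measure.pi (fun _ : Fin n => ν.restrict R)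
        {x | PointSet.ofSet (Set.range x) ∈ voidEvent B} =
          ENNReal.ofReal (ν (R \ B)).toReal ^ n := by
      intro n
      have : {x : Fin n → E | PointSet.ofSet (Set.range x) ∈ voidEvent B} =
          Set.univ.pi fun _ => Bᶜ := by
        ext x
        simp [voidEvent, Set.disjoint_left]
      rw [this, Measure.pi_pi, Measure.restrict_apply hB.compl, ENNReal.ofReal_toReal hfin'']
      simp [Set.sdiff_eq, Set.inter_comm]
    rw [e1, hN.measure_disjoint (hR.inter hB) hfin']
    simp only [e2, mul_assoc]
    rw [ENNReal.tsum_mul_left, tsum_inv_factorial_mul_pow ENNReal.toReal_nonneg,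
      ← ENNReal.ofReal_mul (Real.exp_nonneg _), ← Real.exp_add]
    have hsum : (ν R).toReal = (ν (R ∩ B)).toReal + (ν (R \ B)).toReal := by
      rw [← ENNReal.toReal_add hfin' hfin'', measure_inter_add_sdiff R hB]
    rw [hsum]
    congr 2
    ring
  have hfm : IsFiniteMeasure m₁ := by
    have : IsProbabilityMeasure m₁ :=
      Measure.isProbabilityMeasure_map (hN.measurable_inter hR).aemeasurable
    infer_instance
  have huniv : (Set.univ : Set (PointSet E)) = voidEvent ∅ := by
    ext M
    simp [voidEvent]
  have heq : m₁ = m₂ := by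
    refine ext_of_generate_finite _ rfl isPiSystem_voidEvent ?_ ?_
    · rintro _ ⟨B, hB, rfl⟩
      exact key B hB
    · rw [huniv]
      exact key ∅ MeasurableSet.empty
  rw [← h₁ U hU, heq, h₂ U hU]

/-- The parts of a Poisson process in two disjoint regions are independent. -/
theorem IsPoissonProcess.indepFun_inter [IsProbabilityMeasure P] (hN : IsPoissonProcess N ν P)
    {R R' : Set E} (hR : MeasurableSet R) (hR' : MeasurableSet R') (hfin : ν R ≠ ∞)
    (hfin' : ν R' ≠ ∞) (hdisj : Disjoint R R') :
    IndepFun (fun ω => PointSet.ofSet (N ω ∩ R)) (fun ω => PointSet.ofSet (N ω ∩ R')) P := by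
  rw [IndepFun_iff_Indep]
  refine IndepSets.indep (hN.measurable_inter hR).comap_le (hN.measurable_inter hR').comap_le
    (isPiSystem_voidEvent.comap _) (isPiSystem_voidEvent.comap _)
    MeasurableSpace.comap_generateFrom MeasurableSpace.comap_generateFrom ?_
  rw [IndepSets_iff]
  rintro _ _ ⟨_, ⟨B, hB, rfl⟩, rfl⟩ ⟨_, ⟨B', hB', rfl⟩, rfl⟩
  have e : ∀ R B : Set E, (fun ω => PointSet.ofSet (N ω ∩ R)) ⁻¹' voidEvent B =
      {ω | Disjoint (N ω) (R ∩ B)} := by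
    intro R B
    ext ω
    simp [voidEvent, Set.disjoint_iff_inter_eq_empty, Set.inter_assoc]
  have hf : ν (R ∩ B) ≠ ∞ := ne_top_of_le_ne_top hfin (measure_mono Set.inter_subset_left)
  have hf' : ν (R' ∩ B') ≠ ∞ := ne_top_of_le_ne_top hfin' (measure_mono Set.inter_subset_left)
  have hd : Disjoint (R ∩ B) (R' ∩ B') := hdisj.mono Set.inter_subset_left Set.inter_subset_left
  have e2 : {ω | Disjoint (N ω) (R ∩ B)} ∩ {ω | Disjoint (N ω) (R' ∩ B')} =
      {ω | Disjoint (N ω) (R ∩ B ∪ R' ∩ B')} := by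
    ext ω
    exact Set.disjoint_union_right.symm
  have hu : ν (R ∩ B ∪ R' ∩ B') = ν (R ∩ B) + ν (R' ∩ B') :=
    measure_union hd (hR'.inter hB')
  rw [e, e, e2, hN.measure_disjoint (hR.inter hB) hf, hN.measure_disjoint (hR'.inter hB') hf',
    hN.measure_disjoint ((hR.inter hB).union (hR'.inter hB')) (by simp [hu, hf, hf']), hu,
    ENNReal.toReal_add hf hf', neg_add, Real.exp_add, ENNReal.ofReal_mul (Real.exp_nonneg _)]

end Void

section StableEvents

variable {d : ℕ}

lemma measurableSet_image_discretize_eq (m : ℕ) {C : Set (Point d)}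
    (hC : C ⊆ Set.range (discretize m)) :
    MeasurableSet {M : PointSet (Point d) | discretize m '' M.toSet = C} := by
  have h1 : ∀ c, MeasurableSet {M : PointSet (Point d) | c ∈ discretize m '' M.toSet} := by
    intro c
    have : {M : PointSet (Point d) | c ∈ discretize m '' M.toSet} =
        (voidEvent (discretize m ⁻¹' {c}))ᶜ := by
      ext M
      simp only [voidEvent, Set.mem_ofPred_eq, Set.mem_compl_iff, Set.not_disjoint_iff]
      rfl
    rw [this]
    exact (measurableSet_voidEvent (measurable_discretize m (measurableSet_singleton c))).compl
  have h2 : {M : PointSet (Point d) | discretize m '' M.toSet = C} =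
      ⋂ c ∈ Set.range (discretize (d := d) m),
        {M : PointSet (Point d) | c ∈ discretize m '' M.toSet ↔ c ∈ C} := by
    ext M
    simp only [Set.mem_iInter, Set.mem_ofPred_eq]
    constructor
    · rintro rfl c -
      rfl
    · intro h
      ext c
      by_cases hc : c ∈ Set.range (discretize (d := d) m)
      · exact h c hc
      · exact iff_of_false (fun hc' => hc (Set.image_subset_range _ _ hc')) fun hc' => hc (hC hc')
  rw [h2]
  refine MeasurableSet.biInter (countable_range_discretize m) fun c _ => ?_
  by_cases hc : c ∈ C
  · simpa [hc] using h1 c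
  · simp only [hc, iff_false]
    exact (h1 c).compl

/-- Stable properties are events: a discretized finite set of points takes countably many
values. -/
lemma exists_measurableSet_of_stable {Φ : Set (Point d) → Prop} (hΦ : Stable Φ) :
    ∃ U : Set (PointSet (Point d)), MeasurableSet U ∧
      ∀ M : Set (Point d), M.Finite → (PointSet.ofSet M ∈ U ↔ Φ M) := by
  let 𝒞 : ℕ → Set (Set (Point d)) := fun m =>
    {C | (C.Finite ∧ C ⊆ Set.range (discretize m)) ∧ Φ C}
  have h𝒞 : ∀ m, (𝒞 m).Countable := fun m =>
    (Set.countable_ofPred_finite_subset (countable_range_discretize m)).mono fun C hC => hC.1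
  refine ⟨⋃ k : ℕ, ⋂ m : ℕ, ⋂ _ : k ≤ m, ⋃ C ∈ 𝒞 m,
    {M : PointSet (Point d) | discretize m '' M.toSet = C}, ?_, fun M hM => ?_⟩
  · exact MeasurableSet.iUnion fun k => MeasurableSet.iInter fun m => MeasurableSet.iInter fun _ =>
      MeasurableSet.biUnion (h𝒞 m) fun C hC => measurableSet_image_discretize_eq m hC.1.2
  · simp only [Set.mem_iUnion, Set.mem_iInter, Set.mem_ofPred_eq, exists_prop, exists_eq_right']
    rw [← eventually_atTop (p := fun m => discretize m '' M ∈ 𝒞 m)]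
    have h : ∀ᶠ m in atTop, (discretize m '' M ∈ 𝒞 m ↔ Φ M) := by
      filter_upwards [hΦ M hM] with m hm
      rw [← hm]
      exact ⟨fun h => h.2, fun h => ⟨⟨hM.image _, Set.image_subset_range _ _⟩, h⟩⟩
    exact (eventually_congr h).trans eventually_const

lemma measurableSet_image_of_stable {Φ : Set (Point d) → Prop} (hΦ : Stable Φ) {n : ℕ}
    (S : Finset (Fin n)) : MeasurableSet {x : Fin n → Point d | Φ (x '' S)} := by
  obtain ⟨U, hU, h⟩ := exists_measurableSet_of_stable hΦ
  have : {x : Fin n → Point d | Φ (x '' S)} =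
      (fun x : Fin n → Point d => PointSet.ofSet (x '' S)) ⁻¹' U := by
    ext x
    exact (h _ (S.finite_toSet.image x)).symm
  exact this ▸ measurable_image_toPointSet S hU

variable {Ω : Type*} [MeasurableSpace Ω] {N : Ω → Set (Point d)} {ν : Measure (Point d)}
  {P : Measure Ω}

lemma IsPoissonProcess.ae_eq_of_stable (hN : IsPoissonProcess N ν P) {R : Set (Point d)}
    (hR : MeasurableSet R) (hfin : ν R ≠ ∞) {Φ : Set (Point d) → Prop} {U}
    (hU : ∀ M : Set (Point d), M.Finite → (PointSet.ofSet M ∈ U ↔ Φ M)) :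
    {ω | Φ (N ω ∩ R)} =ᵐ[P] (fun ω => PointSet.ofSet (N ω ∩ R)) ⁻¹' U := by
  filter_upwards [hN.ae_finite_inter hR hfin] with ω hω
  exact propext (hU _ hω).symm

lemma IsPoissonProcess.nullMeasurableSet_of_stable (hN : IsPoissonProcess N ν P)
    {R : Set (Point d)} (hR : MeasurableSet R) (hfin : ν R ≠ ∞) {Φ : Set (Point d) → Prop}
    (hΦ : Stable Φ) : NullMeasurableSet {ω | Φ (N ω ∩ R)} P := by
  obtain ⟨U, hU, h⟩ := exists_measurableSet_of_stable hΦ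
  exact (hN.measurable_inter hR hU).nullMeasurableSet.congr (hN.ae_eq_of_stable hR hfin h).symm

lemma IsPoissonProcess.measure_of_stable [IsProbabilityMeasure P] (hN : IsPoissonProcess N ν P)
    {R : Set (Point d)} (hR : MeasurableSet R) (hfin : ν R ≠ ∞) {Φ : Set (Point d) → Prop}
    (hΦ : Stable Φ) :
    P {ω | Φ (N ω ∩ R)} = ∑' n : ℕ, ENNReal.ofReal (Real.exp (-(ν R).toReal)) *
      (n.factorial : ℝ≥0∞)⁻¹ *
      Measure.pi (fun _ : Fin n => ν.restrict R) {x | Φ (Set.range x)} := by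
  obtain ⟨U, hU, h⟩ := exists_measurableSet_of_stable hΦ
  rw [measure_congr (hN.ae_eq_of_stable hR hfin h)]
  refine (hN.measure_inter_mem hR hfin hU).trans (tsum_congr fun n => ?_)
  congr 2
  ext x
  exact h _ (Set.finite_range x)

lemma IsPoissonProcess.measure_and_of_stable [IsProbabilityMeasure P]
    (hN : IsPoissonProcess N ν P) {R R' : Set (Point d)} (hR : MeasurableSet R)
    (hR' : MeasurableSet R') (hfin : ν R ≠ ∞) (hfin' : ν R' ≠ ∞) (hdisj : Disjoint R R')
    {Φ Ψ : Set (Point d) → Prop} (hΦ : Stable Φ) (hΨ : Stable Ψ) :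
    P {ω | Φ (N ω ∩ R) ∧ Ψ (N ω ∩ R')} = P {ω | Φ (N ω ∩ R)} * P {ω | Ψ (N ω ∩ R')} := by
  obtain ⟨U, hU, h⟩ := exists_measurableSet_of_stable hΦ
  obtain ⟨U', hU', h'⟩ := exists_measurableSet_of_stable hΨ
  have e := hN.ae_eq_of_stable hR hfin h
  have e' := hN.ae_eq_of_stable hR' hfin' h'
  rw [Set.ofPred_and, measure_congr (e.inter e'), measure_congr e, measure_congr e']
  exact (hN.indepFun_inter hR hR' hfin hfin' hdisj).measure_inter_preimage_eq_mul _ _ hU hU'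

end StableEvents

end CycleGas

namespace CycleGas

/-! ### The intensity measure -/

section Intensity

variable {d : ℕ} {V : Site d → ℝ≥0∞} {α : ℝ}

/-- The law of a lifetime. -/
noncomputable def lifeLaw : Measure ℝ≥0 := (expMeasure 1).map Real.toNNReal

instance lifeLaw_isProbabilityMeasure : IsProbabilityMeasure lifeLaw := by
  have := isProbabilityMeasure_expMeasure one_pos
  exact Measure.isProbabilityMeasure_map measurable_real_toNNReal.aemeasurable

lemma lifeLaw_lt {u : ℝ} (hu : 0 ≤ u) :
    lifeLaw {s | u < s} = ENNReal.ofReal (Real.exp (-u)) := by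
  have := isProbabilityMeasure_expMeasure one_pos
  have hm : MeasurableSet {s : ℝ≥0 | u < s} :=
    measurableSet_lt measurable_const NNReal.continuous_coe.measurable
  rw [lifeLaw, Measure.map_apply measurable_real_toNNReal hm]
  have e : Real.toNNReal ⁻¹' {s : ℝ≥0 | u < s} = (Set.Iic u)ᶜ := by
    ext x
    simp [hu]
  have h := cdf_expMeasure_eq one_pos u
  rw [if_pos hu, cdf_eq_real, measureReal_def] at h
  rw [e, prob_compl_eq_one_sub measurableSet_Iic,
    ← ENNReal.ofReal_toReal (measure_ne_top _ (Set.Iic u)), h, ← ENNReal.ofReal_one,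
    ← ENNReal.ofReal_sub _ (by simpa using hu)]
  simp

/-- The intensity of the pairs of a birth and a lifetime for a cycle of weight `1`. -/
noncomputable def timeIntensity : Measure (ℝ × ℝ≥0) := (volume : Measure ℝ).prod lifeLaw

instance timeIntensity_sigmaFinite : SigmaFinite timeIntensity := by
  unfold timeIntensity
  infer_instance

lemma intensity_eq : intensity V α =
    (Measure.count.withDensity (weight V α)).prod timeIntensity := rfl

instance intensity_sFinite : SFinite (intensity V α) := by
  rw [intensity_eq]
  infer_instance

lemma timeIntensity_alive (c : ℝ) : timeIntensity {p | p.1 ≤ c ∧ c < p.1 + p.2} = 1 := by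
  have hm : MeasurableSet {p : ℝ × ℝ≥0 | p.1 ≤ c ∧ c < p.1 + p.2} := by
    have h : Measurable fun p : ℝ × ℝ≥0 => p.1 + (p.2 : ℝ) := by fun_prop
    exact (measurableSet_le measurable_fst measurable_const).inter
      (measurableSet_lt measurable_const h)
  rw [timeIntensity, Measure.prod_apply hm]
  have e : ∀ t : ℝ, lifeLaw (Prod.mk t ⁻¹' {p : ℝ × ℝ≥0 | p.1 ≤ c ∧ c < p.1 + p.2}) =
      (Set.Iic c).indicator (fun t => ENNReal.ofReal (Real.exp (t - c))) t := by
    intro t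
    by_cases ht : t ≤ c
    · rw [Set.indicator_of_mem (by exact ht), ← neg_sub, ← lifeLaw_lt (sub_nonneg.2 ht)]
      congr 1
      ext s
      simp [ht, sub_lt_iff_lt_add']
    · rw [Set.indicator_of_notMem (by exact ht)]
      simp [ht]
  simp_rw [e]
  rw [lintegral_indicator measurableSet_Iic, ← ofReal_integral_eq_lintegral_ofReal]
  · simp_rw [Real.exp_sub]
    rw [integral_div, integral_exp_Iic, div_self (Real.exp_ne_zero c), ENNReal.ofReal_one]
  · simp_rw [Real.exp_sub]
    exact (integrableOn_exp_Iic c).div_const _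
  · exact Eventually.of_forall fun t => Real.exp_nonneg _

lemma weight_le_one (hα : 0 < α) (γ : FinCycle d) : weight V α γ ≤ 1 := boltzmann_le_one hα _

lemma intensity_cycle_prod (γ : FinCycle d) (B : Set (ℝ × ℝ≥0)) :
    intensity V α {φ | φ.1 = γ ∧ φ.2 ∈ B} = weight V α γ * timeIntensity B := by
  have : {φ : Point d | φ.1 = γ ∧ φ.2 ∈ B} = {γ} ×ˢ B := by
    ext φ
    simp
  rw [this, intensity_eq, Measure.prod_prod, withDensity_apply _ (measurableSet_singleton γ)]
  simp

lemma intensity_alive (γ : FinCycle d) (c : ℝ) :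
    intensity V α {φ | φ.1 = γ ∧ φ.2.1 ≤ c ∧ c < φ.2.1 + φ.2.2} = weight V α γ :=
  (intensity_cycle_prod γ {p | p.1 ≤ c ∧ c < p.1 + p.2}).trans (by
    rw [timeIntensity_alive, mul_one])

lemma finite_cyclesIn (Λ : Finset (Site d)) : {γ : FinCycle d | γ.support ⊆ Λ}.Finite := by
  have h : Function.Injective fun γ : {γ : FinCycle d | γ.support ⊆ Λ} =>
      (⟨γ.1.1, fun x hx => by
        by_contra hc
        exact hx (γ.2 ((FinCycle.mem_support γ.1 x).2 hc))⟩ : PermIn Λ) := by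
    intro γ γ' h
    have h' : γ.1.1 = γ'.1.1 := congrArg (fun σ : PermIn Λ => σ.1) h
    exact Subtype.ext (Subtype.ext h')
  have := Finite.of_injective _ h
  exact Set.toFinite _

lemma intensity_cyclesIn_ne_top (hα : 0 < α) (Λ : Finset (Site d)) {B : Set (ℝ × ℝ≥0)}
    (hB : timeIntensity B ≠ ∞) :
    intensity V α {φ | φ.1.support ⊆ Λ ∧ φ.2 ∈ B} ≠ ∞ := by
  have : {φ : Point d | φ.1.support ⊆ Λ ∧ φ.2 ∈ B} ⊆
      ⋃ γ ∈ {γ : FinCycle d | γ.support ⊆ Λ}, {φ | φ.1 = γ ∧ φ.2 ∈ B} := by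
    intro φ hφ
    exact Set.mem_biUnion (x := φ.1) hφ.1 ⟨rfl, hφ.2⟩
  refine ne_top_of_le_ne_top ?_ (measure_mono this)
  refine ((measure_biUnion_lt_top (finite_cyclesIn Λ) fun γ _ => ?_)).ne
  rw [intensity_cycle_prod]
  exact ENNReal.mul_lt_top ((weight_le_one hα γ).trans_lt ENNReal.one_lt_top) hB.lt_top

lemma timeIntensity_birth (s : Set ℝ) : timeIntensity {p | p.1 ∈ s} = volume s := by
  have : {p : ℝ × ℝ≥0 | p.1 ∈ s} = s ×ˢ Set.univ := by
    ext p
    simp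
  rw [this, timeIntensity, Measure.prod_prod, measure_univ, mul_one]

lemma intensity_birth_eq (c : ℝ) : intensity V α {φ | φ.2.1 = c} = 0 := by
  have : {φ : Point d | φ.2.1 = c} = Set.univ ×ˢ {p : ℝ × ℝ≥0 | p.1 ∈ ({c} : Set ℝ)} := by
    ext φ
    simp
  rw [this, intensity_eq, Measure.prod_prod, timeIntensity_birth, measure_singleton, mul_zero]

/-- Time reversal about `c / 2`: births become deaths. -/
def reverse (c : ℝ) (φ : Point d) : Point d := (φ.1, c - (φ.2.1 + φ.2.2), φ.2.2)

/-- Reflection of births about `c / 2`, keeping the lifetimes. -/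
def reflectBirth (c : ℝ) (φ : Point d) : Point d := (φ.1, c - φ.2.1, φ.2.2)

lemma measurePreserving_reverse (c : ℝ) :
    MeasurePreserving (reverse c) (intensity V α) (intensity V α) := by
  have h : MeasurePreserving (fun p : ℝ≥0 × ℝ => (p.1, c - (p.2 + p.1)))
      (lifeLaw.prod volume) (lifeLaw.prod volume) := by
    refine (MeasurePreserving.id lifeLaw).skew_product (g := fun s t => c - (t + s))
      (by fun_prop) (Eventually.of_forall fun s => ?_)
    exact ((Measure.measurePreserving_sub_left volume c).comp
      (measurePreserving_add_right volume (s : ℝ))).map_eq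
  have h2 : MeasurePreserving (fun p : ℝ × ℝ≥0 => (c - (p.1 + p.2), p.2))
      timeIntensity timeIntensity :=
    (Measure.measurePreserving_swap.comp h).comp Measure.measurePreserving_swap
  exact (MeasurePreserving.id _).prod h2

lemma measurePreserving_reflectBirth (c : ℝ) :
    MeasurePreserving (reflectBirth c) (intensity V α) (intensity V α) := by
  have h : MeasurePreserving (fun p : ℝ × ℝ≥0 => (c - p.1, p.2)) timeIntensity timeIntensity :=
    (Measure.measurePreserving_sub_left volume c).prod (MeasurePreserving.id lifeLaw)
  exact (MeasurePreserving.id _).prod h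

lemma reverse_reverse (c : ℝ) (φ : Point d) : reverse c (reverse c φ) = φ := by
  refine Prod.ext rfl (Prod.ext ?_ rfl)
  simp only [reverse]
  ring

lemma measurable_birth : Measurable fun φ : Point d => φ.2.1 := by fun_prop

lemma measurable_death : Measurable fun φ : Point d => φ.2.1 + (φ.2.2 : ℝ) := by fun_prop

lemma intensity_death_eq (c : ℝ) : intensity V α {φ | φ.2.1 + φ.2.2 = c} = 0 := by
  have h := (measurePreserving_reverse (V := V) (α := α) (d := d) 0).measure_preimage
    (measurableSet_eq_fun measurable_birth
      (measurable_const (a := -c))).nullMeasurableSet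
  rw [intensity_birth_eq] at h
  rw [← h]
  congr 1
  ext φ
  simp only [reverse, Set.mem_ofPred_eq, Set.mem_preimage]
  constructor <;> intro h <;> linarith

end Intensity

section Pi

/-- Under a product measure, different coordinates almost surely have different values of a
function whose law has no atoms. -/
lemma ae_pi_ne {E : Type*} [MeasurableSpace E] {μ : Measure E} [IsFiniteMeasure μ] {f : E → ℝ}
    (hf : Measurable f) (h0 : ∀ c, μ {u | f u = c} = 0) {n : ℕ} :
    ∀ᵐ x ∂(Measure.pi fun _ : Fin n => μ), ∀ i j, i ≠ j → f (x i) ≠ f (x j) := by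
  rw [ae_all_iff]
  intro i
  rw [ae_all_iff]
  intro j
  by_cases hij : i = j
  · exact Eventually.of_forall fun x h => absurd hij h
  obtain ⟨m, rfl⟩ : ∃ m, n = m + 1 := ⟨n - 1, by have := i.2; omega⟩
  obtain ⟨k, rfl⟩ := Fin.exists_succAbove_eq (Ne.symm hij)
  have hm : MeasurableSet {p : E × (Fin m → E) | f p.1 = f (p.2 k)} :=
    measurableSet_eq_fun (by fun_prop) (by fun_prop)
  have h1 : (μ.prod (Measure.pi fun _ : Fin m => μ)) {p | f p.1 = f (p.2 k)} = 0 := by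
    rw [Measure.prod_apply_symm hm]
    refine (lintegral_congr fun y => ?_).trans lintegral_zero
    exact h0 (f (y k))
  have h2 := (measurePreserving_piFinSuccAbove (fun _ : Fin (m + 1) => μ) i).measure_preimage
    hm.nullMeasurableSet
  rw [h1] at h2
  filter_upwards [measure_eq_zero_iff_ae_notMem.1 h2] with x hx _ h
  exact hx h

end Pi

end CycleGas

namespace CycleGas

/-! ### Reversibility in a finite space-time window -/

section Window

variable {d : ℕ} {V : Site d → ℝ≥0∞} {α : ℝ}

/-- The points with cycles in `Λ` that are born before `b` and die after `a`. -/
def window (Λ : Finset (Site d)) (a b : ℝ) : Set (Point d) :=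
  {φ | φ.1.support ⊆ Λ ∧ φ.2.1 < b ∧ a < φ.2.1 + φ.2.2}

/-- The points with cycles in `Λ` that are alive at time `a`. -/
def aliveIn (Λ : Finset (Site d)) (a : ℝ) : Set (Point d) :=
  {φ | φ.1.support ⊆ Λ ∧ φ.2.1 ≤ a ∧ a < φ.2.1 + φ.2.2}

/-- The points with cycles in `Λ` that are born between `a` and `b`. -/
def bornIn (Λ : Finset (Site d)) (a b : ℝ) : Set (Point d) :=
  {φ | φ.1.support ⊆ Λ ∧ a < φ.2.1 ∧ φ.2.1 < b}

lemma window_eq_union (Λ : Finset (Site d)) {a b : ℝ} (hab : a < b) :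
    window Λ a b = aliveIn Λ a ∪ bornIn Λ a b := by
  ext φ
  have hs : (0 : ℝ) ≤ φ.2.2 := φ.2.2.2
  simp only [window, aliveIn, bornIn, Set.mem_union, Set.mem_ofPred_eq]
  constructor
  · rintro ⟨h1, h2, h3⟩
    rcases le_or_gt φ.2.1 a with h | h
    · exact Or.inl ⟨h1, h, h3⟩
    · exact Or.inr ⟨h1, h, h2⟩
  · rintro (⟨h1, h2, h3⟩ | ⟨h1, h2, h3⟩)
    · exact ⟨h1, h2.trans_lt hab, h3⟩
    · exact ⟨h1, h3, by linarith⟩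

lemma disjoint_aliveIn_bornIn (Λ : Finset (Site d)) (a b : ℝ) :
    Disjoint (aliveIn Λ a) (bornIn Λ a b) :=
  Set.disjoint_left.2 fun _ h h' => not_lt.2 h.2.1 h'.2.1

lemma measurableSet_cyclesIn (Λ : Finset (Site d)) :
    MeasurableSet {φ : Point d | φ.1.support ⊆ Λ} :=
  measurable_fst (MeasurableSpace.measurableSet_top (s := {γ : FinCycle d | γ.support ⊆ Λ}))

lemma measurableSet_window (Λ : Finset (Site d)) (a b : ℝ) : MeasurableSet (window Λ a b) :=
  (measurableSet_cyclesIn Λ).inter ((measurableSet_lt measurable_birth measurable_const).inter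
    (measurableSet_lt measurable_const measurable_death))

lemma measurableSet_aliveIn (Λ : Finset (Site d)) (a : ℝ) : MeasurableSet (aliveIn Λ a) :=
  (measurableSet_cyclesIn Λ).inter ((measurableSet_le measurable_birth measurable_const).inter
    (measurableSet_lt measurable_const measurable_death))

lemma measurableSet_bornIn (Λ : Finset (Site d)) (a b : ℝ) : MeasurableSet (bornIn Λ a b) :=
  (measurableSet_cyclesIn Λ).inter ((measurableSet_lt measurable_const measurable_birth).inter
    (measurableSet_lt measurable_birth measurable_const))

lemma intensity_aliveIn_ne_top (hα : 0 < α) (Λ : Finset (Site d)) (a : ℝ) :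
    intensity V α (aliveIn Λ a) ≠ ∞ :=
  intensity_cyclesIn_ne_top hα Λ (B := {p | p.1 ≤ a ∧ a < p.1 + p.2}) (by
    rw [timeIntensity_alive]
    exact ENNReal.one_ne_top)

lemma intensity_bornIn_ne_top (hα : 0 < α) (Λ : Finset (Site d)) (a b : ℝ) :
    intensity V α (bornIn Λ a b) ≠ ∞ :=
  intensity_cyclesIn_ne_top hα Λ (B := {p | p.1 ∈ Set.Ioo a b}) (by
    rw [timeIntensity_birth]
    exact measure_Ioo_lt_top.ne)

lemma intensity_window_ne_top (hα : 0 < α) (Λ : Finset (Site d)) {a b : ℝ} (hab : a < b) :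
    intensity V α (window Λ a b) ≠ ∞ := by
  rw [window_eq_union Λ hab]
  exact (measure_union_lt_top (intensity_aliveIn_ne_top hα Λ a).lt_top
    (intensity_bornIn_ne_top hα Λ a b).lt_top).ne

/-- A gas of compatible cycles, with at most one copy of each cycle. -/
def IsCompatibleGas (η : Config d) : Prop :=
  (∀ γ, η γ ≤ 1) ∧ ∀ γ γ', η γ ≠ 0 → η γ' ≠ 0 → γ ≠ γ' → ¬ Incompatible γ γ'

lemma isCompatibleGas_zero : IsCompatibleGas (0 : Config d) :=
  ⟨fun _ => Nat.zero_le _, fun _ _ h => absurd rfl h⟩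

lemma Incompatible.symm {γ γ' : FinCycle d} (h : Incompatible γ γ') : Incompatible γ' γ :=
  fun h' => h h'.symm

lemma aliveCount_congr {M K : Set (Point d)} {c : ℝ}
    (h : ∀ φ : Point d, φ.2.1 ≤ c → c < φ.2.1 + φ.2.2 → (φ ∈ M ↔ φ ∈ K)) :
    aliveCount M c = aliveCount K c := by
  funext γ
  unfold aliveCount
  congr 1
  ext φ
  exact and_congr_left fun h' => h φ h'.2.1 h'.2.2

lemma aliveCount_ne_zero {M : Set (Point d)} (hM : M.Finite) {c : ℝ} {φ : Point d} (hφ : φ ∈ M)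
    (h1 : φ.2.1 ≤ c) (h2 : c < φ.2.1 + φ.2.2) : aliveCount M c φ.1 ≠ 0 := by
  refine (Set.ncard_pos (hM.subset fun ψ hψ => hψ.1)).2 ?_ |>.ne'
  exact ⟨φ, hφ, rfl, h1, h2⟩

/-- If the points of `M` that are alive at time `c` form a compatible gas, then different ones
have compatible cycles. -/
lemma eq_of_incompatible {M : Set (Point d)} (hM : M.Finite) {c : ℝ}
    (hη : IsCompatibleGas (aliveCount M c)) {φ ψ : Point d} (hφ : φ ∈ M) (hψ : ψ ∈ M)
    (h1 : φ.2.1 ≤ c) (h2 : c < φ.2.1 + φ.2.2) (h3 : ψ.2.1 ≤ c) (h4 : c < ψ.2.1 + ψ.2.2)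
    (hi : Incompatible φ.1 ψ.1) : φ = ψ := by
  by_cases hc : φ.1 = ψ.1
  · exact (Set.ncard_le_one (hM.subset fun χ hχ => hχ.1)).1 (hη.1 φ.1) φ ⟨hφ, rfl, h1, h2⟩ ψ
      ⟨hψ, hc.symm, h3, h4⟩
  · exact absurd hi (hη.2 _ _ (aliveCount_ne_zero hM hφ h1 h2) (aliveCount_ne_zero hM hψ h3 h4) hc)

/-- In the window from `a` to `b`, the gas is `η` at time `a` and the loss network is `ζ` at time
`b` if and only if this holds for some ancestor-free set `K`, every other point being born after
`a` and blocked by `K`. This condition on `K` and its complement is symmetric under time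
reversal. -/
lemma aliveCount_and_lossNetwork_iff {Λ : Finset (Site d)} {a b : ℝ} (hab : a < b)
    {M : Set (Point d)} (hM : M.Finite) (hMw : M ⊆ window Λ a b) {η ζ : Config d}
    (hη : IsCompatibleGas η) :
    (aliveCount M a = η ∧ lossNetwork M b = ζ) ↔
      ∃ K ⊆ M, AncestorFree K ∧ aliveCount K a = η ∧ aliveCount K b = ζ ∧
        ∀ φ ∈ M \ K, φ ∈ bornIn Λ a b ∧ (ancestors K φ).Nonempty := by
  constructor
  · rintro ⟨rfl, rfl⟩
    have hk : ∀ φ ∈ M, φ.2.1 ≤ a → a < φ.2.1 + φ.2.2 → φ ∈ kept M := by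
      intro φ hφ h1 h2
      rw [mem_kept_iff (hM.subset (clan_subset M φ))]
      refine ⟨hφ, fun ψ hψ => ?_⟩
      have := eq_of_incompatible hM hη hψ.1 hφ (hψ.2.2.1.le.trans h1) (hMw hψ.1).2.2 h1 h2 hψ.2.1
      exact absurd hψ.2.2.1 (this ▸ lt_irrefl _)
    refine ⟨kept M, kept_subset M, fun φ hφ => ancestors_kept_eq_empty hM hφ,
      aliveCount_congr fun φ h1 h2 => ⟨fun h => kept_subset M h, fun h => hk φ h h1 h2⟩, rfl,
      fun φ hφ => ⟨?_, ancestors_kept_nonempty hM hφ⟩⟩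
    have := hMw hφ.1
    rw [window_eq_union Λ hab] at this
    exact this.resolve_left fun h => hφ.2 (hk φ hφ.1 h.2.1 h.2.2)
  · rintro ⟨K, hKM, hK, rfl, rfl, hD⟩
    have hkept : kept M = K := kept_eq_of_kernel hM hKM hK fun φ hφ => (hD φ hφ).2
    refine ⟨aliveCount_congr fun φ h1 h2 => ⟨fun h => ?_, fun h => hKM h⟩, ?_⟩
    · by_contra hc
      exact absurd (hD φ ⟨h, hc⟩).1.2.1 (not_lt.2 h1)
    · rw [lossNetwork_eq_aliveCount, hkept]

/-- The points `x i`, `i ∈ S`, are the kept ones, with gases `η` and `ζ` at the times `a` and `b`,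
and every other point is born after `a` and blocked by them. -/
def IsKeptPattern (Λ : Finset (Site d)) (a b : ℝ) (η ζ : Config d) {n : ℕ} (S : Finset (Fin n))
    (x : Fin n → Point d) : Prop :=
  (AncestorFree (x '' S) ∧ aliveCount (x '' S) a = η ∧ aliveCount (x '' S) b = ζ) ∧
    ∀ j ∉ S, x j ∈ bornIn Λ a b ∧ ∃ i ∈ S, x i ∈ {ψ | Incompatible ψ.1 (x j).1 ∧
      ψ.2.1 < (x j).2.1 ∧ (x j).2.1 < ψ.2.1 + ψ.2.2}

lemma measurableSet_isKeptPattern (Λ : Finset (Site d)) (a b : ℝ) (η ζ : Config d) {n : ℕ}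
    (S : Finset (Fin n)) : MeasurableSet {x | IsKeptPattern Λ a b η ζ S x} := by
  have h1 := measurableSet_image_of_stable (stable_ancestorFree.and
    ((stable_aliveCount (d := d) a (· = η)).and (stable_aliveCount b (· = ζ)))) S
  have h2 : ∀ i j : Fin n, MeasurableSet {x : Fin n → Point d | Incompatible (x i).1 (x j).1 ∧
      (x i).2.1 < (x j).2.1 ∧ (x j).2.1 < (x i).2.1 + (x i).2.2} := by
    intro i j
    have hc : MeasurableSet {x : Fin n → Point d | Incompatible (x i).1 (x j).1} := by
      have hm : Measurable fun x : Fin n → Point d => ((x i).1, (x j).1) := by fun_prop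
      exact hm ((Set.to_countable
        {p : FinCycle d × FinCycle d | Incompatible p.1 p.2}).measurableSet)
    have hb : ∀ i, Measurable fun x : Fin n → Point d => (x i).2.1 := fun i => by fun_prop
    have hd : Measurable fun x : Fin n → Point d => (x i).2.1 + ((x i).2.2 : ℝ) := by fun_prop
    exact hc.inter ((measurableSet_lt (hb i) (hb j)).inter (measurableSet_lt (hb j) hd))
  have h3 : MeasurableSet {x : Fin n → Point d | ∀ j ∉ S, x j ∈ bornIn Λ a b ∧
      ∃ i ∈ S, Incompatible (x i).1 (x j).1 ∧
        (x i).2.1 < (x j).2.1 ∧ (x j).2.1 < (x i).2.1 + (x i).2.2} := by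
    have : {x : Fin n → Point d | ∀ j ∉ S, x j ∈ bornIn Λ a b ∧
      ∃ i ∈ S, Incompatible (x i).1 (x j).1 ∧
        (x i).2.1 < (x j).2.1 ∧ (x j).2.1 < (x i).2.1 + (x i).2.2} =
        ⋂ j, ⋂ (_ : j ∉ S), ({x | x j ∈ bornIn Λ a b} ∩ ⋃ i ∈ S,
          {x : Fin n → Point d | Incompatible (x i).1 (x j).1 ∧
            (x i).2.1 < (x j).2.1 ∧ (x j).2.1 < (x i).2.1 + (x i).2.2}) := by
      ext x
      simp only [Set.mem_iInter, Set.mem_inter_iff, Set.mem_iUnion, Set.mem_ofPred_eq, exists_prop]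
    rw [this]
    refine MeasurableSet.iInter fun j => MeasurableSet.iInter fun _ => MeasurableSet.inter ?_ ?_
    · exact measurable_pi_apply j (measurableSet_bornIn Λ a b)
    · exact Finset.measurableSet_biUnion _ fun i _ => h2 i j
  exact h1.inter h3

lemma IsKeptPattern.kept_eq {Λ : Finset (Site d)} {a b : ℝ} {η ζ : Config d} {n : ℕ}
    {S : Finset (Fin n)} {x : Fin n → Point d} (h : IsKeptPattern Λ a b η ζ S x) :
    kept (Set.range x) = x '' S := by
  refine kept_eq_of_kernel (Set.finite_range x) (Set.image_subset_range _ _) h.1.1 ?_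
  rintro _ ⟨⟨j, rfl⟩, hj⟩
  obtain ⟨-, i, hi, hij⟩ := h.2 j fun hS => hj ⟨j, hS, rfl⟩
  exact ⟨x i, ⟨i, hi, rfl⟩, hij⟩

lemma aliveCount_and_lossNetwork_range_iff {Λ : Finset (Site d)} {a b : ℝ} (hab : a < b)
    {n : ℕ} {x : Fin n → Point d} (hxw : ∀ i, x i ∈ window Λ a b)
    {η ζ : Config d} (hη : IsCompatibleGas η) :
    (aliveCount (Set.range x) a = η ∧ lossNetwork (Set.range x) b = ζ) ↔
      ∃ S, IsKeptPattern Λ a b η ζ S x := by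
  classical
  rw [aliveCount_and_lossNetwork_iff hab (Set.finite_range x) (Set.range_subset_iff.2 hxw) hη]
  constructor
  · rintro ⟨K, hK, h1, h2, h3, h4⟩
    have hS : x '' (Finset.univ.filter fun i => x i ∈ K : Finset (Fin n)) = K := by
      ext φ
      constructor
      · rintro ⟨i, hi, rfl⟩
        exact (Finset.mem_filter.1 hi).2
      · intro hφ
        obtain ⟨i, rfl⟩ := hK hφ
        exact ⟨i, Finset.mem_coe.2 (Finset.mem_filter.2 ⟨Finset.mem_univ i, hφ⟩), rfl⟩
    refine ⟨Finset.univ.filter fun i => x i ∈ K, ?_, fun j hj => ?_⟩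
    · rw [hS]
      exact ⟨h1, h2, h3⟩
    · have hj' : x j ∉ K := fun h => hj (Finset.mem_filter.2 ⟨Finset.mem_univ j, h⟩)
      obtain ⟨h5, ψ, hψ⟩ := h4 (x j) ⟨⟨j, rfl⟩, hj'⟩
      obtain ⟨i, rfl⟩ := hK hψ.1
      exact ⟨h5, i, Finset.mem_filter.2 ⟨Finset.mem_univ i, hψ.1⟩, hψ.2⟩
  · rintro ⟨S, h, h'⟩
    refine ⟨x '' S, Set.image_subset_range _ _, h.1, h.2.1, h.2.2, ?_⟩
    rintro _ ⟨⟨j, rfl⟩, hj⟩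
    obtain ⟨h5, i, hi, hij⟩ := h' j fun hS => hj ⟨j, hS, rfl⟩
    exact ⟨h5, x i, ⟨i, hi, rfl⟩, hij⟩

open Classical in
/-- Reflection of births about the middle of the window, applied only to the points that are born
inside it. -/
noncomputable def reflectBornIn (Λ : Finset (Site d)) (a b : ℝ) (φ : Point d) : Point d :=
  if φ ∈ bornIn Λ a b then reflectBirth (a + b) φ else φ

lemma reflectBirth_preimage_bornIn (Λ : Finset (Site d)) (a b : ℝ) :
    reflectBirth (a + b) ⁻¹' bornIn Λ a b = bornIn Λ a b := by
  ext φ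
  simp only [reflectBirth, bornIn, Set.mem_preimage, Set.mem_ofPred_eq]
  refine and_congr_right fun _ => ⟨fun h => ⟨?_, ?_⟩, fun h => ⟨?_, ?_⟩⟩ <;> linarith [h.1, h.2]

lemma reverse_preimage_window (Λ : Finset (Site d)) (a b : ℝ) :
    reverse (a + b) ⁻¹' window Λ a b = window Λ a b := by
  ext φ
  simp only [reverse, window, Set.mem_preimage, Set.mem_ofPred_eq]
  refine and_congr_right fun _ => ⟨fun h => ⟨?_, ?_⟩, fun h => ⟨?_, ?_⟩⟩ <;> linarith [h.1, h.2]

lemma measurePreserving_reverse_window (Λ : Finset (Site d)) (a b : ℝ) :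
    MeasurePreserving (reverse (a + b)) ((intensity V α).restrict (window Λ a b))
      ((intensity V α).restrict (window Λ a b)) := by
  have h := (measurePreserving_reverse (V := V) (α := α) (a + b)).restrict_preimage
    (measurableSet_window Λ a b)
  rwa [reverse_preimage_window] at h

lemma measurePreserving_reflectBornIn (Λ : Finset (Site d)) {a b : ℝ} (hab : a < b) :
    MeasurePreserving (reflectBornIn Λ a b) ((intensity V α).restrict (window Λ a b))
      ((intensity V α).restrict (window Λ a b)) := by
  classical
  have hB := measurableSet_bornIn Λ a b
  have hmp := measurePreserving_reflectBirth (d := d) (V := V) (α := α) (a + b)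
  have hm : Measurable (reflectBornIn Λ a b) := Measurable.ite hB hmp.measurable measurable_id
  have hBW : bornIn Λ a b ⊆ window Λ a b := by
    rw [window_eq_union Λ hab]
    exact Set.subset_union_right
  refine ⟨hm, Measure.ext fun s hs => ?_⟩
  rw [Measure.map_apply hm hs, ← measure_inter_add_sdiff _ hB,
    ← measure_inter_add_sdiff s hB]
  congr 1
  · have e : reflectBornIn Λ a b ⁻¹' s ∩ bornIn Λ a b =
        reflectBirth (a + b) ⁻¹' (s ∩ bornIn Λ a b) := by
      rw [Set.preimage_inter, reflectBirth_preimage_bornIn]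
      ext φ
      refine and_congr_left fun h => ?_
      simp [reflectBornIn, h]
    have e' : reflectBirth (a + b) ⁻¹' (s ∩ bornIn Λ a b) ⊆ window Λ a b := by
      rw [← e]
      exact Set.inter_subset_right.trans hBW
    rw [e, Measure.restrict_eq_self _ e', hmp.measure_preimage (hs.inter hB).nullMeasurableSet,
      Measure.restrict_eq_self _ (Set.inter_subset_right.trans hBW)]
  · congr 1
    ext φ
    refine and_congr_left fun h => ?_
    simp [reflectBornIn, h]

open Classical in
/-- Time reversal of the points `x i`, `i ∈ S`, with reflection of the births of the others. -/
noncomputable def reversePattern (Λ : Finset (Site d)) (a b : ℝ) {n : ℕ} (S : Finset (Fin n))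
    (x : Fin n → Point d) (i : Fin n) : Point d :=
  if i ∈ S then reverse (a + b) (x i) else reflectBornIn Λ a b (x i)

lemma measurePreserving_reversePattern (hα : 0 < α) (Λ : Finset (Site d)) {a b : ℝ} (hab : a < b)
    {n : ℕ} (S : Finset (Fin n)) :
    MeasurePreserving (reversePattern Λ a b S)
      (Measure.pi fun _ : Fin n => (intensity V α).restrict (window Λ a b))
      (Measure.pi fun _ : Fin n => (intensity V α).restrict (window Λ a b)) := by
  classical
  have : Fact (intensity V α (window Λ a b) < ∞) := ⟨(intensity_window_ne_top hα Λ hab).lt_top⟩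
  refine measurePreserving_pi (f := fun i φ =>
    if i ∈ S then reverse (a + b) φ else reflectBornIn Λ a b φ) _ _ fun i => ?_
  by_cases hi : i ∈ S
  · simpa only [hi, if_true] using measurePreserving_reverse_window Λ a b
  · simpa only [hi, if_false] using measurePreserving_reflectBornIn Λ hab

lemma aliveCount_reverse_image {K : Set (Point d)} {a b : ℝ}
    (hK : ∀ φ ∈ K, φ.2.1 ≠ b ∧ φ.2.1 + φ.2.2 ≠ b) :
    aliveCount (reverse (a + b) '' K) a = aliveCount K b := by
  funext γ
  have he : {φ ∈ reverse (a + b) '' K | φ.1 = γ ∧ φ.2.1 ≤ a ∧ a < φ.2.1 + φ.2.2} =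
      reverse (a + b) '' {φ ∈ K | φ.1 = γ ∧ φ.2.1 ≤ b ∧ b < φ.2.1 + φ.2.2} := by
    ext χ
    constructor
    · rintro ⟨⟨φ, hφ, rfl⟩, h1, h2, h3⟩
      simp only [reverse] at h1 h2 h3
      refine ⟨φ, ⟨hφ, h1, by linarith, lt_of_le_of_ne (by linarith) (hK φ hφ).2.symm⟩, rfl⟩
    · rintro ⟨φ, ⟨hφ, h1, h2, h3⟩, rfl⟩
      have := lt_of_le_of_ne h2 (hK φ hφ).1
      refine ⟨⟨φ, hφ, rfl⟩, h1, ?_, ?_⟩ <;> simp only [reverse] <;> linarith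
  rw [aliveCount, aliveCount, he]
  exact (Function.LeftInverse.injective (reverse_reverse (a + b))).injOn.ncard_image

/-- Time reversal exchanges the gases at the ends of the window. The births have to be different,
since two incompatible points that are born together are not ancestors of each other, but can be so
when time is reversed. -/
lemma IsKeptPattern.reversePattern {Λ : Finset (Site d)} {a b : ℝ} {η ζ : Config d} {n : ℕ}
    {S : Finset (Fin n)} {x : Fin n → Point d} (h : IsKeptPattern Λ a b η ζ S x)
    (hne : ∀ i j, i ≠ j → (x i).2.1 ≠ (x j).2.1)
    (ha : ∀ i, (x i).2.1 ≠ a ∧ (x i).2.1 + (x i).2.2 ≠ a)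
    (hb : ∀ i, (x i).2.1 ≠ b ∧ (x i).2.1 + (x i).2.2 ≠ b) :
    IsKeptPattern Λ a b ζ η S (reversePattern Λ a b S x) := by
  have hS : CycleGas.reversePattern Λ a b S x '' S = reverse (a + b) '' (x '' S) := by
    rw [Set.image_image]
    refine Set.image_congr fun i hi => ?_
    exact if_pos (Finset.mem_coe.1 hi)
  obtain ⟨⟨h1, h2, h3⟩, h4⟩ := h
  refine ⟨?_, fun j hj => ?_⟩
  · rw [hS]
    refine ⟨?_, ?_, ?_⟩
    · rintro _ ⟨_, ⟨i, hi, rfl⟩, rfl⟩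
      refine Set.subset_empty_iff.1 ?_
      rintro _ ⟨⟨_, ⟨j, hj, rfl⟩, rfl⟩, hc, h5, h6⟩
      simp only [reverse] at hc h5 h6
      have hij : i ≠ j := by
        rintro rfl
        exact lt_irrefl _ h5
      have hs : (0 : ℝ) ≤ (x i).2.2 := (x i).2.2.2
      -- The intervals of life overlap, so the point that is born later has the other as ancestor.
      rcases lt_or_gt_of_ne (hne i j hij) with hl | hl
      · exact Set.eq_empty_iff_forall_notMem.1 (h1 (x j) ⟨j, hj, rfl⟩) (x i)
          ⟨⟨i, hi, rfl⟩, hc.symm, hl, by linarith⟩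
      · exact Set.eq_empty_iff_forall_notMem.1 (h1 (x i) ⟨i, hi, rfl⟩) (x j)
          ⟨⟨j, hj, rfl⟩, hc, hl, by linarith⟩
    · rw [aliveCount_reverse_image, h3]
      rintro _ ⟨i, -, rfl⟩
      exact hb i
    · rw [add_comm, aliveCount_reverse_image, h2]
      rintro _ ⟨i, -, rfl⟩
      exact ha i
  · obtain ⟨h5, i, hi, hc, h6, h7⟩ := h4 j hj
    have ej : CycleGas.reversePattern Λ a b S x j = reflectBirth (a + b) (x j) := by
      simp only [CycleGas.reversePattern, hj, if_false, reflectBornIn, h5, if_true]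
    have ei : CycleGas.reversePattern Λ a b S x i = reverse (a + b) (x i) := if_pos hi
    rw [ej]
    refine ⟨?_, i, hi, ?_⟩
    · rwa [← Set.mem_preimage, reflectBirth_preimage_bornIn]
    · rw [ei]
      refine ⟨hc, ?_, ?_⟩ <;> simp only [reverse, reflectBirth] <;> linarith

/-- Almost surely all births are different, and no birth or death is at an end of the window. -/
lemma ae_generic (hα : 0 < α) (Λ : Finset (Site d)) {a b : ℝ} (hab : a < b) {n : ℕ} :
    ∀ᵐ x ∂(Measure.pi fun _ : Fin n => (intensity V α).restrict (window Λ a b)),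
      (∀ i j, i ≠ j → (x i).2.1 ≠ (x j).2.1) ∧ ∀ i, x i ∈ window Λ a b ∧
        ((x i).2.1 ≠ a ∧ (x i).2.1 + (x i).2.2 ≠ a) ∧
        ((x i).2.1 ≠ b ∧ (x i).2.1 + (x i).2.2 ≠ b) := by
  have : Fact (intensity V α (window Λ a b) < ∞) := ⟨(intensity_window_ne_top hα Λ hab).lt_top⟩
  have h0 : ∀ c, (intensity V α).restrict (window Λ a b) {φ | φ.2.1 = c} = 0 := fun c =>
    Measure.absolutelyContinuous_of_le Measure.restrict_le_self (intensity_birth_eq c)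
  have h0' : ∀ c, (intensity V α).restrict (window Λ a b) {φ | φ.2.1 + φ.2.2 = c} = 0 := fun c =>
    Measure.absolutelyContinuous_of_le Measure.restrict_le_self (intensity_death_eq c)
  have h1 : ∀ᵐ φ ∂((intensity V α).restrict (window Λ a b)), φ ∈ window Λ a b ∧
      (φ.2.1 ≠ a ∧ φ.2.1 + φ.2.2 ≠ a) ∧ (φ.2.1 ≠ b ∧ φ.2.1 + φ.2.2 ≠ b) := by
    filter_upwards [ae_restrict_mem (measurableSet_window Λ a b),
      measure_eq_zero_iff_ae_notMem.1 (h0 a), measure_eq_zero_iff_ae_notMem.1 (h0' a),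
      measure_eq_zero_iff_ae_notMem.1 (h0 b), measure_eq_zero_iff_ae_notMem.1 (h0' b)]
      with φ hφ h1 h2 h3 h4
    exact ⟨hφ, ⟨h1, h2⟩, h3, h4⟩
  refine (ae_pi_ne measurable_birth h0).and (ae_all_iff.2 fun i => ?_)
  exact (Measure.tendsto_eval_ae_ae (μ := fun _ : Fin n =>
    (intensity V α).restrict (window Λ a b)) (i := i)).eventually h1

/-- By time reversal; the inequality is enough, as `η` and `ζ` can be interchanged. -/
lemma measure_isKeptPattern_le (hα : 0 < α) (Λ : Finset (Site d)) {a b : ℝ} (hab : a < b) {n : ℕ}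
    (S : Finset (Fin n)) (η ζ : Config d) :
    (Measure.pi fun _ : Fin n => (intensity V α).restrict (window Λ a b))
        {x | IsKeptPattern Λ a b η ζ S x} ≤
      (Measure.pi fun _ : Fin n => (intensity V α).restrict (window Λ a b))
        {x | IsKeptPattern Λ a b ζ η S x} := by
  rw [← (measurePreserving_reversePattern hα Λ hab S).measure_preimage
    (measurableSet_isKeptPattern Λ a b ζ η S).nullMeasurableSet]
  refine measure_mono_ae ?_
  filter_upwards [ae_generic hα Λ hab] with x hx h
  exact IsKeptPattern.reversePattern h hx.1 (fun i => (hx.2 i).2.1) fun i => (hx.2 i).2.2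

lemma measure_range_eq_sum (hα : 0 < α) (Λ : Finset (Site d)) {a b : ℝ} (hab : a < b) (n : ℕ)
    {η ζ : Config d} (hη : IsCompatibleGas η) :
    (Measure.pi fun _ : Fin n => (intensity V α).restrict (window Λ a b))
        {x | aliveCount (Set.range x) a = η ∧ lossNetwork (Set.range x) b = ζ} =
      ∑' S : Finset (Fin n), (Measure.pi fun _ : Fin n => (intensity V α).restrict (window Λ a b))
        {x | IsKeptPattern Λ a b η ζ S x} := by
  have hinj : ∀ᵐ x ∂(Measure.pi fun _ : Fin n => (intensity V α).restrict (window Λ a b)),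
      Function.Injective x := by
    filter_upwards [ae_generic hα Λ hab] with x hx i j hij
    by_contra hne
    exact hx.1 i j hne (by rw [hij])
  rw [← measure_iUnion₀]
  · refine measure_congr ?_
    filter_upwards [ae_generic hα Λ hab] with x hx
    refine propext ((aliveCount_and_lossNetwork_range_iff hab (fun i => (hx.2 i).1) hη).trans ?_)
    change _ ↔ x ∈ ⋃ S : Finset (Fin n), {x | IsKeptPattern Λ a b η ζ S x}
    simp only [Set.mem_iUnion, Set.mem_ofPred_eq]
  · intro S S' hne
    refine measure_eq_zero_iff_ae_notMem.2 ?_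
    filter_upwards [hinj] with x hx
    rintro ⟨h, h'⟩
    have := (IsKeptPattern.kept_eq h).symm.trans (IsKeptPattern.kept_eq h')
    exact hne (Finset.coe_injective (hx.image_injective this))
  · exact fun S => (measurableSet_isKeptPattern Λ a b η ζ S).nullMeasurableSet

variable {Ω : Type*} [MeasurableSpace Ω] {P : Measure Ω} [IsProbabilityMeasure P]
  {N : Ω → Set (Point d)}

/-- Reversibility: the free gas at time `a` and the loss network of the window at time `b` can
be interchanged, as long as both are compatible gases. -/
theorem measure_aliveCount_and_lossNetwork_comm (hα : 0 < α)
    (hN : IsPoissonProcess N (intensity V α) P) (Λ : Finset (Site d)) {a b : ℝ} (hab : a < b)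
    {η ζ : Config d} (hη : IsCompatibleGas η) (hζ : IsCompatibleGas ζ) :
    P {ω | aliveCount (N ω ∩ window Λ a b) a = η ∧ lossNetwork (N ω ∩ window Λ a b) b = ζ} =
      P {ω | aliveCount (N ω ∩ window Λ a b) a = ζ ∧ lossNetwork (N ω ∩ window Λ a b) b = η} := by
  have hst : ∀ η ζ : Config d, Stable fun M => aliveCount M a = η ∧ lossNetwork M b = ζ :=
    fun η ζ => (stable_aliveCount a (· = η)).and (stable_lossNetwork b (· = ζ))
  have hW := measurableSet_window Λ a b
  have hf := intensity_window_ne_top (V := V) hα Λ hab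
  rw [hN.measure_of_stable hW hf (hst η ζ), hN.measure_of_stable hW hf (hst ζ η)]
  refine tsum_congr fun n => ?_
  rw [measure_range_eq_sum hα Λ hab n hη, measure_range_eq_sum hα Λ hab n hζ]
  congr 1
  exact tsum_congr fun S => le_antisymm (measure_isKeptPattern_le hα Λ hab S η ζ)
    (measure_isKeptPattern_le hα Λ hab S ζ η)

/-- Almost surely, no two points of the window are born at the same time. -/
lemma ae_not_hasSimultaneousBirths (hα : 0 < α) (hN : IsPoissonProcess N (intensity V α) P)
    (Λ : Finset (Site d)) {a b : ℝ} (hab : a < b) :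
    ∀ᵐ ω ∂P, ¬ HasSimultaneousBirths (N ω ∩ window Λ a b) := by
  refine measure_eq_zero_iff_ae_notMem.1 ((hN.measure_of_stable (measurableSet_window Λ a b)
    (intensity_window_ne_top hα Λ hab) stable_hasSimultaneousBirths).trans ?_)
  refine ENNReal.tsum_eq_zero.2 fun n => ?_
  refine mul_eq_zero_of_right _ (measure_eq_zero_iff_ae_notMem.2 ?_)
  filter_upwards [ae_generic hα Λ hab] with x hx
  rintro ⟨_, ⟨i, rfl⟩, _, ⟨j, rfl⟩, hne, he⟩
  exact hx.1 i j (fun hij => hne (by rw [hij])) he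

end Window

end CycleGas

namespace CycleGas

/-! ### Locality of the loss network -/

section Locality

variable {d : ℕ} {N N' : Set (Point d)} {t : ℝ}

lemma FinCycle.support_nonempty (γ : FinCycle d) : γ.support.Nonempty := by
  obtain ⟨x, hx, -⟩ := γ.2.1
  exact ⟨x, (γ.mem_support x).2 hx⟩

lemma finite_alive_of_mem_support (hfin : ∀ φ, (clan N φ).Finite) (ht : ∀ φ ∈ N, φ.2.1 ≠ t)
    (x : Site d) : {φ ∈ N | x ∈ φ.1.support ∧ φ.2.1 ≤ t ∧ t < φ.2.1 + φ.2.2}.Finite := by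
  rcases Set.eq_empty_or_nonempty
    {φ ∈ N | x ∈ φ.1.support ∧ φ.2.1 ≤ t ∧ t < φ.2.1 + φ.2.2} with h | ⟨χ, -, hχ, -⟩
  · simp [h]
  · -- All of these points are ancestors of a point `(γ, t, s)` whose cycle goes through `x`.
    refine (hfin (χ.1, t, 0)).subset fun φ hφ => ancestors_subset_clan _ _ ⟨hφ.1, ?_, ?_, hφ.2.2.2⟩
    · exact Finset.not_disjoint_iff.2 ⟨x, hφ.2.1, hχ⟩
    · exact lt_of_le_of_ne hφ.2.2.1 (ht φ hφ.1)

/-- A finite set of points has finitely many ancestors in all. -/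
lemma exists_finite_ancestry (hfin : ∀ φ, (clan N φ).Finite) {A : Set (Point d)} (hA : A.Finite)
    (hAN : A ⊆ N) : ∃ B : Set (Point d), B.Finite ∧ B ⊆ N ∧ ∀ φ ∈ A, φ ∈ B ∧ clan N φ ⊆ B :=
  ⟨A ∪ ⋃ φ ∈ A, clan N φ, hA.union (hA.biUnion fun φ _ => hfin φ),
    Set.union_subset hAN (Set.iUnion₂_subset fun φ _ => clan_subset N φ), fun _ hφ =>
    ⟨Or.inl hφ, fun _ hψ => Or.inr (Set.mem_biUnion hφ hψ)⟩⟩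

lemma lossNetwork_eq_of_ancestry (hfin : ∀ φ, (clan N φ).Finite) (h : N' ⊆ N) {γ : FinCycle d}
    (hγ : ∀ φ ∈ N, φ.1 = γ → φ.2.1 ≤ t → t < φ.2.1 + φ.2.2 → φ ∈ N' ∧ clan N φ ⊆ N') :
    lossNetwork N' t γ = lossNetwork N t γ := by
  unfold lossNetwork
  congr 1
  ext φ
  refine and_congr_left fun hφ => ?_
  by_cases hN : φ ∈ N
  · have h' := hγ φ hN hφ.1 hφ.2.1 hφ.2.2
    exact mem_kept_iff_of_clan_subset h h'.1 (hfin φ) h'.2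
  · exact iff_of_false (fun hk => hN (h (kept_subset _ hk))) fun hk => hN (kept_subset _ hk)

lemma restrictTo_subset (N : Set (Point d)) (Λ : Set (Site d)) : restrictTo N Λ ⊆ N :=
  fun _ h => h.1

lemma finite_clan_mono (h : N' ⊆ N) (hfin : ∀ φ, (clan N φ).Finite) (φ : Point d) :
    (clan N' φ).Finite :=
  (hfin φ).subset (clan_mono h φ)

/-- In large enough volumes, the cycles through `x` in the loss network are those of the infinite
volume. -/
lemma exists_finset_lossNetwork_restrictTo_eq (hfin : ∀ φ, (clan N φ).Finite)
    (ht : ∀ φ ∈ N, φ.2.1 ≠ t) (x : Site d) :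
    ∃ F : Finset (Site d), ∀ Λ : Set (Site d), (F : Set (Site d)) ⊆ Λ →
      ∀ γ : FinCycle d, x ∈ γ.support →
        lossNetwork (restrictTo N Λ) t γ = lossNetwork N t γ := by
  classical
  obtain ⟨B, hB, hBN, h⟩ := exists_finite_ancestry hfin (finite_alive_of_mem_support hfin ht x)
    fun φ hφ => hφ.1
  refine ⟨hB.toFinset.biUnion fun φ => φ.1.support, fun Λ hΛ γ hx => ?_⟩
  have hsub : B ⊆ restrictTo N Λ := fun φ hφ => ⟨hBN hφ, fun y hy => hΛ (Finset.mem_coe.2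
    (Finset.mem_biUnion.2 ⟨φ, hB.mem_toFinset.2 hφ, hy⟩))⟩
  refine lossNetwork_eq_of_ancestry hfin (restrictTo_subset N Λ) fun φ hφ h1 h2 h3 => ?_
  have h' := h φ ⟨hφ, h1 ▸ hx, h2, h3⟩
  exact ⟨hsub h'.1, h'.2.trans hsub⟩

/-- In a finite volume, the loss network depends only on a finite part of the past. -/
lemma eventually_lossNetwork_eq (hfin : ∀ φ, (clan N φ).Finite) (ht : ∀ φ ∈ N, φ.2.1 ≠ t)
    (Λ : Finset (Site d)) : ∀ᶠ n : ℕ in atTop,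
      lossNetwork (N ∩ bornIn Λ (t - (n + 1)) t) t = lossNetwork (restrictTo N Λ) t ∧
      lossNetwork (N ∩ window Λ (t - (n + 1)) t) t = lossNetwork (restrictTo N Λ) t := by
  have hA : {φ ∈ restrictTo N Λ | φ.2.1 ≤ t ∧ t < φ.2.1 + φ.2.2}.Finite := by
    refine (Λ.finite_toSet.biUnion fun x _ => finite_alive_of_mem_support hfin ht x).subset ?_
    intro φ hφ
    obtain ⟨x, hx⟩ := φ.1.support_nonempty
    exact Set.mem_biUnion (x := x) (hφ.1.2 hx) ⟨hφ.1.1, hx, hφ.2⟩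
  have hfin' := finite_clan_mono (restrictTo_subset N Λ) hfin
  obtain ⟨B, hB, hBN, h⟩ := exists_finite_ancestry hfin' hA fun φ hφ => hφ.1
  have hA' : ∀ φ ∈ restrictTo N Λ, φ.2.1 ≤ t → t < φ.2.1 + φ.2.2 →
      φ ∈ B ∩ {ψ | ψ.2.1 < t} ∧ clan (restrictTo N Λ) φ ⊆ B ∩ {ψ | ψ.2.1 < t} := by
    intro φ hφ h1 h2
    have h' := h φ ⟨hφ, h1, h2⟩
    refine ⟨⟨h'.1, lt_of_le_of_ne h1 (ht φ hφ.1)⟩, fun ψ hψ => ⟨h'.2 hψ, ?_⟩⟩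
    exact (birth_lt_of_mem_clan hψ).trans_le h1
  obtain ⟨c, hc⟩ := (hB.image fun φ : Point d => φ.2.1).bddBelow
  obtain ⟨k, hk⟩ := exists_nat_gt (t - c)
  filter_upwards [eventually_ge_atTop k] with n hn
  have hkn : (k : ℝ) ≤ n := by exact_mod_cast hn
  have hsub : B ∩ {ψ | ψ.2.1 < t} ⊆ N ∩ bornIn Λ (t - (n + 1)) t := by
    rintro φ ⟨hφ, hφt⟩
    have h1 : c ≤ φ.2.1 := hc ⟨φ, hφ, rfl⟩
    exact ⟨(hBN hφ).1, fun x hx => Finset.mem_coe.1 ((hBN hφ).2 (Finset.mem_coe.2 hx)),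
      by linarith, hφt⟩
  have hbw : bornIn Λ (t - (n + 1)) t ⊆ window Λ (t - (n + 1)) t := by
    rw [window_eq_union Λ (by linarith [(n.cast_nonneg : (0 : ℝ) ≤ n)])]
    exact Set.subset_union_right
  have key : ∀ N', N' ⊆ restrictTo N Λ → N ∩ bornIn Λ (t - (n + 1)) t ⊆ N' →
      lossNetwork N' t = lossNetwork (restrictTo N Λ) t := fun N' h1 h2 => funext fun γ =>
    lossNetwork_eq_of_ancestry hfin' h1 fun φ hφ _ h3 h4 =>
      ⟨h2 (hsub (hA' φ hφ h3 h4).1), (hA' φ hφ h3 h4).2.trans (hsub.trans h2)⟩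
  exact ⟨key _ (fun φ hφ => ⟨hφ.1, fun x hx => hφ.2.1 hx⟩) subset_rfl,
    key _ (fun φ hφ => ⟨hφ.1, fun x hx => hφ.2.1 hx⟩) (Set.inter_subset_inter_right _ hbw)⟩

/-- The gas of the loss network is compatible: of two incompatible kept points, the one born later
is born after the death of the other. -/
lemma isCompatibleGas_lossNetwork (hfin : ∀ φ, (clan N φ).Finite)
    (hne : ∀ φ ∈ N, ∀ ψ ∈ N, φ.2.1 = ψ.2.1 → φ = ψ) : IsCompatibleGas (lossNetwork N t) := by
  have key : ∀ φ ∈ kept N, ∀ ψ ∈ kept N, Incompatible φ.1 ψ.1 → φ.2.1 ≤ t → t < φ.2.1 + φ.2.2 →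
      ψ.2.1 ≤ t → t < ψ.2.1 + ψ.2.2 → φ = ψ := by
    intro φ hφ ψ hψ hi h1 h2 h3 h4
    rcases lt_trichotomy φ.2.1 ψ.2.1 with h | h | h
    · exact absurd hφ (((mem_kept_iff (hfin ψ)).1 hψ).2 φ
        ⟨kept_subset N hφ, hi, h, h3.trans_lt h2⟩)
    · exact hne φ (kept_subset N hφ) ψ (kept_subset N hψ) h
    · exact absurd hψ (((mem_kept_iff (hfin φ)).1 hφ).2 ψ
        ⟨kept_subset N hψ, hi.symm, h, h1.trans_lt h4⟩)
  have hself : ∀ γ : FinCycle d, Incompatible γ γ := fun γ => by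
    obtain ⟨x, hx⟩ := γ.support_nonempty
    exact Finset.not_disjoint_iff.2 ⟨x, hx, hx⟩
  refine ⟨fun γ => ?_, fun γ γ' h h' hγ hi => ?_⟩
  · have hsub : {φ ∈ kept N | φ.1 = γ ∧ φ.2.1 ≤ t ∧ t < φ.2.1 + φ.2.2}.Subsingleton := by
      rintro φ ⟨hφ, rfl, h1, h2⟩ ψ ⟨hψ, h, h3, h4⟩
      exact key φ hφ ψ hψ (h ▸ hself _) h1 h2 h3 h4
    exact (Set.ncard_le_one hsub.finite).2 fun φ hφ ψ hψ => hsub hφ hψ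
  · obtain ⟨φ, hφ, rfl, h1, h2⟩ := Set.nonempty_of_ncard_ne_zero h
    obtain ⟨ψ, hψ, rfl, h3, h4⟩ := Set.nonempty_of_ncard_ne_zero h'
    exact hγ (congrArg Prod.fst (key φ hφ ψ hψ hi h1 h2 h3 h4))

end Locality

/-! ### The law of the loss network in a finite volume -/

section FiniteVolume

variable {d : ℕ} {V : Site d → ℝ≥0∞} {α : ℝ} {Ω : Type*} [MeasurableSpace Ω] {P : Measure Ω}
  {N : Ω → Set (Point d)}

lemma ae_birth_ne (hN : IsPoissonProcess N (intensity V α) P) (t : ℝ) :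
    ∀ᵐ ω ∂P, ∀ φ ∈ N ω, φ.2.1 ≠ t := by
  filter_upwards [hN.ae_disjoint (measurableSet_eq_fun measurable_birth measurable_const)
    (intensity_birth_eq t)] with ω hω φ hφ h
  exact Set.disjoint_left.1 hω hφ h

lemma ae_birth_injective [IsProbabilityMeasure P] (hα : 0 < α)
    (hN : IsPoissonProcess N (intensity V α) P) :
    ∀ᵐ ω ∂P, ∀ φ ∈ N ω, ∀ ψ ∈ N ω, φ.2.1 = ψ.2.1 → φ = ψ := by
  classical
  have h : ∀ᵐ ω ∂P, ∀ (Λ : Finset (Site d)) (n : ℕ),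
      ¬ HasSimultaneousBirths (N ω ∩ window Λ (-(n + 1)) (n + 1)) := by
    refine ae_all_iff.2 fun Λ => ae_all_iff.2 fun n => ae_not_hasSimultaneousBirths hα hN Λ ?_
    have : (0 : ℝ) ≤ n := n.cast_nonneg
    linarith
  filter_upwards [h] with ω hω φ hφ ψ hψ he
  by_contra hne
  obtain ⟨n, hn⟩ := exists_nat_gt |φ.2.1|
  rw [abs_lt] at hn
  have h1 : (0 : ℝ) ≤ φ.2.2 := φ.2.2.2
  have h2 : (0 : ℝ) ≤ ψ.2.2 := ψ.2.2.2
  refine hω (φ.1.support ∪ ψ.1.support) n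
    ⟨φ, ⟨hφ, Finset.subset_union_left, ?_, ?_⟩, ψ, ⟨hψ, Finset.subset_union_right, ?_, ?_⟩, hne, he⟩
  all_goals linarith [hn.1, hn.2]

lemma aemeasurable_lossNetwork_inter (hN : IsPoissonProcess N (intensity V α) P)
    {R : Set (Point d)} (hR : MeasurableSet R) (hfin : intensity V α R ≠ ∞) (t : ℝ) :
    AEMeasurable (fun ω => lossNetwork (N ω ∩ R) t) P := by
  refine aemeasurable_pi_lambda _ fun γ => NullMeasurable.aemeasurable fun s _ => ?_
  exact hN.nullMeasurableSet_of_stable hR hfin (stable_lossNetwork t fun η => η γ ∈ s)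

lemma aemeasurable_lossNetwork_restrictTo (hα : 0 < α)
    (hN : IsPoissonProcess N (intensity V α) P)
    (hclan : ∀ᵐ ω ∂P, ∀ φ : Point d, (clan (N ω) φ).Finite) (Λ : Finset (Site d)) (t : ℝ) :
    AEMeasurable (fun ω => lossNetwork (restrictTo (N ω) Λ) t) P := by
  refine aemeasurable_pi_lambda _ fun γ => aemeasurable_of_tendsto_metrizable_ae atTop
    (f := fun (n : ℕ) ω => lossNetwork (N ω ∩ bornIn Λ (t - (n + 1)) t) t γ) (fun n => ?_) ?_
  · exact (measurable_pi_apply γ).comp_aemeasurable (aemeasurable_lossNetwork_inter hN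
      (measurableSet_bornIn Λ _ _) (intensity_bornIn_ne_top hα Λ _ _) t)
  · filter_upwards [hclan, ae_birth_ne hN t] with ω h1 h2
    refine tendsto_const_nhds.congr' ?_
    filter_upwards [eventually_lossNetwork_eq h1 h2 Λ] with n hn
    rw [hn.1]

/-- If almost surely the events `A n` and `B n` agree for large `n`, then their probabilities have
the same limit. -/
lemma tendsto_measure_of_ae_eventually_iff [IsProbabilityMeasure P] {A B : ℕ → Set Ω}
    (hA : ∀ n, NullMeasurableSet (A n) P) (hB : ∀ n, NullMeasurableSet (B n) P)
    (h : ∀ᵐ ω ∂P, ∀ᶠ n in atTop, (ω ∈ A n ↔ ω ∈ B n))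
    {L : ℝ≥0∞} (hL : Tendsto (fun n => P (B n)) atTop (𝓝 L)) :
    Tendsto (fun n => P (A n)) atTop (𝓝 L) := by
  let D : ℕ → Set Ω := fun n => {ω | ¬ (ω ∈ A n ↔ ω ∈ B n)}
  have hDm : ∀ n, NullMeasurableSet (D n) P := fun n => by
    have : D n = (A n \ B n) ∪ (B n \ A n) := by
      ext ω
      simp only [D, Set.mem_ofPred_eq, Set.mem_union, Set.mem_sdiff]
      tauto
    exact this ▸ ((hA n).diff (hB n)).union ((hB n).diff (hA n))
  have h0 : P (⋂ n, ⋃ m, ⋃ (_ : n ≤ m), D m) = 0 := by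
    refine measure_eq_zero_iff_ae_notMem.2 ?_
    filter_upwards [h] with ω hω hc
    obtain ⟨n, hn⟩ := eventually_atTop.1 hω
    obtain ⟨m, hm, hD⟩ := Set.mem_iUnion₂.1 (Set.mem_iInter.1 hc n)
    exact hD (hn m hm)
  have hU : Tendsto (fun n => P (⋃ m, ⋃ (_ : n ≤ m), D m)) atTop (𝓝 0) := by
    rw [← h0]
    refine tendsto_measure_iInter_atTop
      (fun n => NullMeasurableSet.iUnion fun m => NullMeasurableSet.iUnion fun _ => hDm m)
      (fun n n' hn => Set.iUnion_mono fun m => Set.iUnion_subset fun hm =>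
        Set.subset_iUnion_of_subset (le_trans hn hm) subset_rfl) ⟨0, measure_ne_top _ _⟩
  have hD0 : Tendsto (fun n => P (D n)) atTop (𝓝 0) :=
    tendsto_of_tendsto_of_tendsto_of_le_of_le tendsto_const_nhds hU (fun n => zero_le)
      fun n => measure_mono (Set.subset_iUnion₂_of_subset n le_rfl subset_rfl)
  have h1 : ∀ n, P (A n) ≤ P (B n) + P (D n) := fun n => by
    refine (measure_mono fun ω hω => ?_).trans (measure_union_le (B n) (D n))
    by_cases hb : ω ∈ B n
    · exact Or.inl hb
    · exact Or.inr fun h => hb (h.1 hω)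
  have h2 : ∀ n, P (B n) ≤ P (A n) + P (D n) := fun n => by
    refine (measure_mono fun ω hω => ?_).trans (measure_union_le (A n) (D n))
    by_cases hb : ω ∈ A n
    · exact Or.inl hb
    · exact Or.inr fun h => hb (h.2 hω)
  have hL' : L ≠ ∞ := by
    have : L ≤ 1 := le_of_tendsto' hL fun n => prob_le_one
    exact ne_top_of_le_ne_top ENNReal.one_ne_top this
  refine tendsto_of_tendsto_of_tendsto_of_le_of_le (g := fun n => P (B n) - P (D n))
    (h := fun n => P (B n) + P (D n)) ?_ ?_ (fun n => tsub_le_iff_right.2 (h2 n)) h1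
  · simpa using ENNReal.Tendsto.sub hL hD0 (Or.inl hL')
  · simpa using hL.add hD0

/-- The cycles with support in `Λ`. -/
noncomputable def cyclesIn (Λ : Finset (Site d)) : Finset (FinCycle d) :=
  (finite_cyclesIn Λ).toFinset

lemma mem_cyclesIn {Λ : Finset (Site d)} {γ : FinCycle d} :
    γ ∈ cyclesIn Λ ↔ γ.support ⊆ Λ := by
  simp [cyclesIn]

/-- The points with cycles in `Λ` that are alive at a fixed time form a gas of independent
Poisson variables. -/
lemma measure_aliveCount_eq (hα : 0 < α) (hN : IsPoissonProcess N (intensity V α) P)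
    (Λ : Finset (Site d)) (a : ℝ) {η : Config d} (hη : IsCompatibleGas η)
    (hηΛ : ∀ γ, η γ ≠ 0 → γ.support ⊆ Λ) :
    P {ω | aliveCount (N ω ∩ aliveIn Λ a) a = η} =
      ∏ γ ∈ cyclesIn Λ, ENNReal.ofReal (Real.exp (-(weight V α γ).toReal)) *
        weight V α γ ^ η γ := by
  let B : FinCycle d → Set (Point d) := fun γ =>
    {φ | φ.1 = γ ∧ φ.2.1 ≤ a ∧ a < φ.2.1 + φ.2.2}
  have hBm : ∀ γ, MeasurableSet (B γ) := fun γ =>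
    (measurable_fst (measurableSet_singleton γ)).inter
      ((measurableSet_le measurable_birth measurable_const).inter
      (measurableSet_lt measurable_const measurable_death))
  have hBν : ∀ γ, intensity V α (B γ) = weight V α γ := fun γ => intensity_alive γ a
  have hw : ∀ γ, weight V α γ ≠ ∞ := fun γ =>
    ne_top_of_le_ne_top ENNReal.one_ne_top (weight_le_one hα γ)
  let e := (cyclesIn Λ).equivFin.symm
  have hind := hN.indep_count _ (fun i => B (e i)) (fun i => hBm _) fun i j hij =>
    Set.disjoint_left.2 fun φ h h' => hij (e.injective (Subtype.ext (h.1.symm.trans h'.1)))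
  have h1 := hind.measure_inter_preimage_eq_mul Finset.univ
    (sets := fun i => {(η (e i) : ℕ∞)}) fun i _ => measurableSet_singleton _
  have h2 : ∀ γ, P {ω | (N ω ∩ B γ).encard = η γ} =
      ENNReal.ofReal (Real.exp (-(weight V α γ).toReal)) * weight V α γ ^ η γ := by
    intro γ
    rw [hN.measure_encard_eq (hBm γ) ((hBν γ).symm ▸ hw γ), hBν]
    have h3 : η γ = 0 ∨ η γ = 1 := by
      have := hη.1 γ
      omega
    rcases h3 with h3 | h3
    · simp [h3]
    · simp [h3, ENNReal.ofReal_mul (Real.exp_nonneg _), ENNReal.ofReal_toReal (hw γ)]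
  have h3 : {ω | aliveCount (N ω ∩ aliveIn Λ a) a = η} =ᵐ[P]
      ⋂ i ∈ (Finset.univ : Finset (Fin (cyclesIn Λ).card)),
        (fun ω => (N ω ∩ B (e i)).encard) ⁻¹' {(η (e i) : ℕ∞)} := by
    filter_upwards [hN.ae_finite_inter (measurableSet_aliveIn Λ a)
      (intensity_aliveIn_ne_top hα Λ a)] with ω hω
    refine propext ?_
    change aliveCount (N ω ∩ aliveIn Λ a) a = η ↔ ω ∈ ⋂ i ∈ _, _
    simp only [Set.mem_iInter, Set.mem_preimage, Set.mem_singleton_iff, Finset.mem_univ,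
      forall_true_left]
    have h4 : ∀ γ ∈ cyclesIn Λ, ((N ω ∩ B γ).encard = η γ ↔
        aliveCount (N ω ∩ aliveIn Λ a) a γ = η γ) := by
      intro γ hγ
      have hs : N ω ∩ B γ = {φ ∈ N ω ∩ aliveIn Λ a | φ.1 = γ ∧ φ.2.1 ≤ a ∧ a < φ.2.1 + φ.2.2} := by
        ext φ
        refine ⟨fun h => ⟨⟨h.1, ?_, h.2.2⟩, h.2⟩, fun h => ⟨h.1.1, h.2⟩⟩
        rw [h.2.1]
        exact mem_cyclesIn.1 hγ
      have hf : (N ω ∩ B γ).Finite := by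
        rw [hs]
        exact hω.subset fun φ hφ => hφ.1
      rw [← hf.cast_ncard_eq, Nat.cast_inj, hs]
      rfl
    constructor
    · rintro h i
      exact (h4 _ (e i).2).2 (congrFun h _)
    · intro h
      funext γ
      by_cases hγ : γ ∈ cyclesIn Λ
      · refine (h4 γ hγ).1 ?_
        simpa using h (e.symm ⟨γ, hγ⟩)
      · have h5 : η γ = 0 := by
          by_contra hc
          exact hγ (mem_cyclesIn.2 (hηΛ γ hc))
        rw [h5, aliveCount, Set.ncard_eq_zero (hω.subset fun φ hφ => hφ.1)]
        refine Set.eq_empty_iff_forall_notMem.2 fun φ hφ => hγ (mem_cyclesIn.2 ?_)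
        exact hφ.2.1 ▸ hφ.1.2.1
  rw [measure_congr h3, h1]
  have h5 : ∀ i, P ((fun ω => (N ω ∩ B (e i)).encard) ⁻¹' {(η (e i) : ℕ∞)}) =
      ENNReal.ofReal (Real.exp (-(weight V α (e i)).toReal)) * weight V α (e i) ^ η (e i) :=
    fun i => h2 (e i)
  simp only [h5]
  rw [Equiv.prod_comp e fun γ : cyclesIn Λ =>
    ENNReal.ofReal (Real.exp (-(weight V α γ).toReal)) * weight V α γ ^ η γ]
  exact Finset.prod_coe_sort (cyclesIn Λ) fun γ =>
    ENNReal.ofReal (Real.exp (-(weight V α γ).toReal)) * weight V α γ ^ η γ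

/-- In a finite volume, a compatible gas `η` has probability proportional to the product of the
weights of its cycles. The gas alive at a distant time `a` in the past is independent of the points
born after `a`, and has no influence on the loss network at time `t`; so letting `a → -∞` in the
reversibility relation between `η` and the empty gas gives the claim. -/
theorem measure_lossNetwork_restrictTo_eq [IsProbabilityMeasure P] (hα : 0 < α)
    (hN : IsPoissonProcess N (intensity V α) P)
    (hclan : ∀ᵐ ω ∂P, ∀ φ : Point d, (clan (N ω) φ).Finite) (Λ : Finset (Site d)) (t : ℝ)
    {η : Config d} (hη : IsCompatibleGas η) (hηΛ : ∀ γ, η γ ≠ 0 → γ.support ⊆ Λ) :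
    P {ω | lossNetwork (restrictTo (N ω) Λ) t = η} =
      (∏ γ ∈ cyclesIn Λ, weight V α γ ^ η γ) *
        P {ω | lossNetwork (restrictTo (N ω) Λ) t = 0} := by
  let a : ℕ → ℝ := fun n => t - (n + 1)
  have hat : ∀ n, a n < t := fun n => by
    have : (0 : ℝ) ≤ n := n.cast_nonneg
    simp only [a]
    linarith
  let W : ℕ → Set (Point d) := fun n => window Λ (a n) t
  have hq : ∀ n, ∀ ζ : Config d, IsCompatibleGas ζ → (∀ γ, ζ γ ≠ 0 → γ.support ⊆ Λ) →
      P {ω | aliveCount (N ω ∩ aliveIn Λ (a n)) (a n) = ζ} =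
      (∏ γ ∈ cyclesIn Λ, ENNReal.ofReal (Real.exp (-(weight V α γ).toReal))) *
        ∏ γ ∈ cyclesIn Λ, weight V α γ ^ ζ γ := fun n ζ h1 h2 => by
    rw [measure_aliveCount_eq hα hN Λ (a n) h1 h2, Finset.prod_mul_distrib]
  set q : ℝ≥0∞ := ∏ γ ∈ cyclesIn Λ, ENNReal.ofReal (Real.exp (-(weight V α γ).toReal)) with hqdef
  have hq0 : q ≠ 0 := Finset.prod_ne_zero_iff.2 fun γ _ => by
    rw [ne_eq, ENNReal.ofReal_eq_zero, not_le]
    exact Real.exp_pos _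
  have hqT : q ≠ ∞ := (ENNReal.prod_lt_top fun γ _ => ENNReal.ofReal_lt_top).ne
  have h0Λ : ∀ γ, (0 : Config d) γ ≠ 0 → γ.support ⊆ Λ := fun γ h => absurd rfl h
  have hind : ∀ n (ζ ξ : Config d), P {ω | aliveCount (N ω ∩ aliveIn Λ (a n)) (a n) = ζ ∧
      lossNetwork (N ω ∩ bornIn Λ (a n) t) t = ξ} =
      P {ω | aliveCount (N ω ∩ aliveIn Λ (a n)) (a n) = ζ} *
        P {ω | lossNetwork (N ω ∩ bornIn Λ (a n) t) t = ξ} := fun n ζ ξ =>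
    hN.measure_and_of_stable (measurableSet_aliveIn Λ _) (measurableSet_bornIn Λ _ _)
      (intensity_aliveIn_ne_top hα Λ _) (intensity_bornIn_ne_top hα Λ _ _)
      (disjoint_aliveIn_bornIn Λ _ _) (stable_aliveCount _ (· = ζ)) (stable_lossNetwork _ (· = ξ))
  have hacount : ∀ n ω, aliveCount (N ω ∩ W n) (a n) =
      aliveCount (N ω ∩ aliveIn Λ (a n)) (a n) := fun n ω => aliveCount_congr fun φ h1 h2 =>
    ⟨fun h => ⟨h.1, h.2.1, h1, h2⟩, fun h => ⟨h.1, h.2.1, h1.trans_lt (hat n), h2⟩⟩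
  have hloss : ∀ᵐ ω ∂P, ∀ᶠ n : ℕ in atTop,
      lossNetwork (N ω ∩ bornIn Λ (a n) t) t = lossNetwork (restrictTo (N ω) Λ) t ∧
      lossNetwork (N ω ∩ W n) t = lossNetwork (restrictTo (N ω) Λ) t := by
    filter_upwards [hclan, ae_birth_ne hN t] with ω h1 h2
    exact eventually_lossNetwork_eq h1 h2 Λ
  have hmB : ∀ n (ξ : Config d),
      NullMeasurableSet {ω | lossNetwork (N ω ∩ bornIn Λ (a n) t) t = ξ} P := fun n ξ =>
    hN.nullMeasurableSet_of_stable (measurableSet_bornIn Λ _ _) (intensity_bornIn_ne_top hα Λ _ _)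
      (stable_lossNetwork t (· = ξ))
  have hmL : ∀ ξ : Config d, NullMeasurableSet {ω | lossNetwork (restrictTo (N ω) Λ) t = ξ} P :=
    fun ξ => (aemeasurable_lossNetwork_restrictTo hα hN hclan Λ t).nullMeasurableSet_preimage
      (measurableSet_singleton ξ)
  have hlim : ∀ ξ : Config d, Tendsto (fun n => P {ω | lossNetwork (N ω ∩ bornIn Λ (a n) t) t = ξ})
      atTop (𝓝 (P {ω | lossNetwork (restrictTo (N ω) Λ) t = ξ})) := by
    intro ξ
    refine tendsto_measure_of_ae_eventually_iff (fun n => hmB n ξ) (fun n => hmL ξ) ?_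
      tendsto_const_nhds
    filter_upwards [hloss] with ω hω
    filter_upwards [hω] with n hn
    simp only [hn.1]
  -- With the empty gas at time `a n`, the window contains only points that are born later.
  have hleft : ∀ n, P {ω | aliveCount (N ω ∩ W n) (a n) = 0 ∧ lossNetwork (N ω ∩ W n) t = η} =
      q * P {ω | lossNetwork (N ω ∩ bornIn Λ (a n) t) t = η} := by
    intro n
    have h1 := hind n 0 η
    rw [hq n 0 isCompatibleGas_zero h0Λ] at h1
    simp only [Pi.zero_apply, pow_zero, Finset.prod_const_one, mul_one] at h1
    rw [← h1]
    refine measure_congr ?_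
    filter_upwards [hN.ae_finite_inter (measurableSet_window Λ (a n) t)
      (intensity_window_ne_top hα Λ (hat n))] with ω hω
    refine propext ?_
    change (aliveCount (N ω ∩ W n) (a n) = 0 ∧ _) ↔ (_ ∧ _)
    rw [← hacount]
    refine and_congr_right fun h0 => ?_
    have : N ω ∩ W n = N ω ∩ bornIn Λ (a n) t := by
      refine Set.Subset.antisymm (fun φ hφ => ⟨hφ.1, ?_⟩) (Set.inter_subset_inter_right _ ?_)
      · have h2 := hφ.2
        simp only [W] at h2
        rw [window_eq_union Λ (hat n)] at h2
        refine h2.resolve_left fun h => ?_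
        exact aliveCount_ne_zero hω hφ h.2.1 h.2.2 (congrFun h0 _)
      · simp only [W]
        rw [window_eq_union Λ (hat n)]
        exact Set.subset_union_right
    rw [this]
  have hL : Tendsto (fun n => P {ω | aliveCount (N ω ∩ W n) (a n) = 0 ∧
      lossNetwork (N ω ∩ W n) t = η}) atTop
      (𝓝 (q * P {ω | lossNetwork (restrictTo (N ω) Λ) t = η})) := by
    simp only [hleft]
    exact ENNReal.Tendsto.const_mul (hlim η) (Or.inr hqT)
  have hR : Tendsto (fun n => P {ω | aliveCount (N ω ∩ W n) (a n) = η ∧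
      lossNetwork (N ω ∩ W n) t = 0}) atTop
      (𝓝 (q * (∏ γ ∈ cyclesIn Λ, weight V α γ ^ η γ) *
        P {ω | lossNetwork (restrictTo (N ω) Λ) t = 0})) := by
    refine tendsto_measure_of_ae_eventually_iff (B := fun n =>
      {ω | aliveCount (N ω ∩ aliveIn Λ (a n)) (a n) = η ∧
        lossNetwork (N ω ∩ bornIn Λ (a n) t) t = 0}) (fun n => ?_) (fun n => ?_) ?_ ?_
    · exact hN.nullMeasurableSet_of_stable (measurableSet_window Λ _ _)
        (intensity_window_ne_top hα Λ (hat n))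
        ((stable_aliveCount (a n) (· = η)).and (stable_lossNetwork t (· = 0)))
    · exact (hN.nullMeasurableSet_of_stable (measurableSet_aliveIn Λ _)
        (intensity_aliveIn_ne_top hα Λ _) (stable_aliveCount (a n) (· = η))).inter (hmB n 0)
    · filter_upwards [hloss] with ω hω
      filter_upwards [hω] with n hn
      simp only [hacount, hn.1, hn.2]
    · simp only [hind]
      have hprod : q * (∏ γ ∈ cyclesIn Λ, weight V α γ ^ η γ) ≠ ∞ := by
        rw [← hq 0 η hη hηΛ]
        exact measure_ne_top _ _
      simp only [fun n => hq n η hη hηΛ]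
      exact ENNReal.Tendsto.const_mul (hlim 0) (Or.inr hprod)
  have hrev : ∀ n, P {ω | aliveCount (N ω ∩ W n) (a n) = 0 ∧ lossNetwork (N ω ∩ W n) t = η} =
      P {ω | aliveCount (N ω ∩ W n) (a n) = η ∧ lossNetwork (N ω ∩ W n) t = 0} := fun n =>
    measure_aliveCount_and_lossNetwork_comm hα hN Λ (hat n) isCompatibleGas_zero hη
  simp only [hrev] at hL
  have := tendsto_nhds_unique hL hR
  rw [mul_assoc] at this
  exact (ENNReal.mul_right_inj hq0 hqT).1 this

end FiniteVolume

end CycleGas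

namespace CycleGas

/-! ### Permutations and compatible gases of cycles -/

section Permutations

variable {d : ℕ} {σ : Permutation d} {γ γ' : FinCycle d} {η η' : Config d} {x y : Site d}

/-- The finite cycle `γ` is one of the cycles of `σ`. -/
def HasCycle (σ : Permutation d) (γ : FinCycle d) : Prop := ∀ x ∈ γ.support, σ x = γ.1 x

open Classical in
lemma cyclesOf_apply (σ : Permutation d) (γ : FinCycle d) :
    cyclesOf σ γ = if HasCycle σ γ then 1 else 0 :=
  if_congr Iff.rfl rfl rfl

lemma cyclesOf_ne_zero : cyclesOf σ γ ≠ 0 ↔ HasCycle σ γ := by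
  simp [cyclesOf_apply]

lemma FinCycle.zpow_mem_support (γ : FinCycle d) (i : ℤ) :
    (γ.1 ^ i) x ∈ γ.support ↔ x ∈ γ.support := by
  simp only [FinCycle.mem_support, ne_eq]
  rw [← Equiv.Perm.mul_apply, ← zpow_one_add, add_comm, zpow_add, Equiv.Perm.mul_apply, zpow_one,
    (γ.1 ^ i).injective.eq_iff]

lemma HasCycle.zpow_apply (h : HasCycle σ γ) (hx : x ∈ γ.support) (i : ℤ) :
    (σ ^ i) x = (γ.1 ^ i) x := by
  induction i using Int.induction_on with
  | zero => rfl
  | succ i ih =>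
    rw [add_comm, zpow_one_add, zpow_one_add, Equiv.Perm.mul_apply, Equiv.Perm.mul_apply, ih]
    exact h _ ((γ.zpow_mem_support _).2 hx)
  | pred i ih =>
    apply σ.injective
    have e : ∀ τ : Permutation d, τ ((τ ^ (-(i : ℤ) - 1)) x) = (τ ^ (-(i : ℤ))) x := fun τ => by
      rw [← Equiv.Perm.mul_apply, ← zpow_one_add]
      congr 2
      ring
    rw [e σ, ih, h _ ((γ.zpow_mem_support _).2 hx), e γ.1]

lemma HasCycle.mem_support_iff (h : HasCycle σ γ) (hx : x ∈ γ.support) :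
    y ∈ γ.support ↔ σ.SameCycle x y := by
  constructor
  · intro hy
    obtain ⟨i, hi⟩ := γ.2.1.sameCycle ((γ.mem_support x).1 hx) ((γ.mem_support y).1 hy)
    exact ⟨i, (h.zpow_apply hx i).trans hi⟩
  · rintro ⟨i, rfl⟩
    rw [h.zpow_apply hx i]
    exact (γ.zpow_mem_support i).2 hx

lemma HasCycle.unique (h : HasCycle σ γ) (h' : HasCycle σ γ') (hx : x ∈ γ.support)
    (hx' : x ∈ γ'.support) : γ = γ' := by
  have hs : ∀ y, y ∈ γ.support ↔ y ∈ γ'.support := fun y =>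
    (h.mem_support_iff hx).trans (h'.mem_support_iff hx').symm
  refine Subtype.ext (Equiv.ext fun y => ?_)
  by_cases hy : y ∈ γ.support
  · rw [← h y hy, h' y ((hs y).1 hy)]
  · have hy' := mt (hs y).2 hy
    rw [FinCycle.mem_support, not_not] at hy hy'
    rw [hy, hy']

lemma isCompatibleGas_cyclesOf (σ : Permutation d) : IsCompatibleGas (cyclesOf σ) := by
  refine ⟨fun γ => ?_, fun γ γ' h h' hne hi => ?_⟩
  · rw [cyclesOf_apply]
    split_ifs <;> simp
  · obtain ⟨x, hx, hx'⟩ := Finset.not_disjoint_iff.1 hi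
    exact hne ((cyclesOf_ne_zero.1 h).unique (cyclesOf_ne_zero.1 h') hx hx')

lemma IsCompatibleGas.unique (hη : IsCompatibleGas η) (h : η γ ≠ 0) (h' : η γ' ≠ 0)
    (hx : x ∈ γ.support) (hx' : x ∈ γ'.support) : γ = γ' := by
  by_contra hne
  exact hη.2 γ γ' h h' hne (Finset.not_disjoint_iff.2 ⟨x, hx, hx'⟩)

open Classical in
/-- The image of `x` under the cycle of the gas through `x`, where `e` selects the cycle itself or
its inverse. -/
noncomputable def moveBy (e : FinCycle d → Permutation d) (η : Config d) (x : Site d) : Site d :=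
  if h : ∃ γ, η γ ≠ 0 ∧ x ∈ γ.support then e h.choose x else x

lemma moveBy_eq (e : FinCycle d → Permutation d) (hη : IsCompatibleGas η) (h : η γ ≠ 0)
    (hx : x ∈ γ.support) : moveBy e η x = e γ x := by
  have hex : ∃ γ, η γ ≠ 0 ∧ x ∈ γ.support := ⟨γ, h, hx⟩
  rw [moveBy, dif_pos hex, hη.unique hex.choose_spec.1 h hex.choose_spec.2 hx]

lemma moveBy_eq_self (e : FinCycle d → Permutation d) (h : ∀ γ, η γ ≠ 0 → x ∉ γ.support) :
    moveBy e η x = x :=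
  dif_neg fun ⟨γ, h1, h2⟩ => h γ h1 h2

lemma moveBy_moveBy {e e' : FinCycle d → Permutation d} (he : ∀ γ x, e' γ (e γ x) = x)
    (hs : ∀ γ, ∀ x ∈ γ.support, e γ x ∈ γ.support) (hη : IsCompatibleGas η) (x : Site d) :
    moveBy e' η (moveBy e η x) = x := by
  by_cases h : ∃ γ, η γ ≠ 0 ∧ x ∈ γ.support
  · obtain ⟨γ, hγ, hx⟩ := h
    rw [moveBy_eq e hη hγ hx, moveBy_eq e' hη hγ (hs γ x hx), he]
  · push Not at h
    rw [moveBy_eq_self e h, moveBy_eq_self e' h]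

open Classical in
/-- The permutation whose cycles are those of a compatible gas; the identity, if the gas is not
compatible. -/
noncomputable def permOf (η : Config d) : Permutation d :=
  if hη : IsCompatibleGas η then
    { toFun := moveBy (fun γ => γ.1) η
      invFun := moveBy (fun γ => γ.1⁻¹) η
      left_inv := moveBy_moveBy (fun γ x => by simp)
        (fun γ x hx => by simpa using (γ.zpow_mem_support 1).2 hx) hη
      right_inv := moveBy_moveBy (fun γ x => by simp)
        (fun γ x hx => by simpa using (γ.zpow_mem_support (-1)).2 hx) hη }
  else 1

lemma permOf_apply (hη : IsCompatibleGas η) (h : η γ ≠ 0) (hx : x ∈ γ.support) :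
    permOf η x = γ.1 x := by
  rw [permOf, dif_pos hη]
  exact moveBy_eq _ hη h hx

lemma permOf_apply_eq_self (hη : IsCompatibleGas η) (h : ∀ γ, η γ ≠ 0 → x ∉ γ.support) :
    permOf η x = x := by
  rw [permOf, dif_pos hη]
  exact moveBy_eq_self _ h

lemma hasCycle_permOf (hη : IsCompatibleGas η) (h : η γ ≠ 0) : HasCycle (permOf η) γ :=
  fun _ hx => permOf_apply hη h hx

lemma permOf_congr (hη : IsCompatibleGas η) (hη' : IsCompatibleGas η')
    (h : ∀ γ, x ∈ γ.support → η γ = η' γ) : permOf η x = permOf η' x := by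
  by_cases hx : ∃ γ, η γ ≠ 0 ∧ x ∈ γ.support
  · obtain ⟨γ, hγ, hx⟩ := hx
    rw [permOf_apply hη hγ hx, permOf_apply hη' (h γ hx ▸ hγ) hx]
  · push Not at hx
    rw [permOf_apply_eq_self hη hx, permOf_apply_eq_self hη' fun γ hγ hx' =>
      hx γ ((h γ hx').symm ▸ hγ) hx']

lemma cyclesOf_permOf (hη : IsCompatibleGas η) : cyclesOf (permOf η) = η := by
  have key : ∀ γ, HasCycle (permOf η) γ ↔ η γ ≠ 0 := by
    refine fun γ => ⟨fun h => ?_, hasCycle_permOf hη⟩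
    obtain ⟨x, hx⟩ := γ.support_nonempty
    by_cases hex : ∃ γ', η γ' ≠ 0 ∧ x ∈ γ'.support
    · obtain ⟨γ', hγ', hx'⟩ := hex
      rwa [h.unique (hasCycle_permOf hη hγ') hx hx']
    · push Not at hex
      exact absurd ((h x hx).symm.trans (permOf_apply_eq_self hη hex)) ((γ.mem_support x).1 hx)
  funext γ
  have h1 := hη.1 γ
  rw [cyclesOf_apply]
  split_ifs with h
  · have := (key γ).1 h
    omega
  · exact (not_not.1 (mt (key γ).2 h)).symm

lemma isFiniteCyclePerm_permOf (hη : IsCompatibleGas η) : IsFiniteCyclePerm (permOf η) := by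
  intro x
  by_cases h : ∃ γ, η γ ≠ 0 ∧ x ∈ γ.support
  · obtain ⟨γ, hγ, hx⟩ := h
    exact γ.support.finite_toSet.subset fun y hy =>
      ((hasCycle_permOf hη hγ).mem_support_iff hx).2 hy
  · push Not at h
    refine (Set.finite_singleton x).subset fun y hy => ?_
    obtain ⟨i, rfl⟩ := hy
    exact Equiv.Perm.zpow_apply_eq_self_of_apply_eq_self (permOf_apply_eq_self hη h) i

lemma IsFiniteCyclePerm.exists_hasCycle (hσ : IsFiniteCyclePerm σ) (hx : σ x ≠ x) :
    ∃ γ : FinCycle d, HasCycle σ γ ∧ x ∈ γ.support := by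
  classical
  have hs : ∀ y, σ.cycleOf x y ≠ y → σ.SameCycle x y := fun y hy => by
    by_contra hc
    exact hy (Equiv.Perm.cycleOf_apply_of_not_sameCycle hc)
  obtain ⟨γ, hγ⟩ : ∃ γ : FinCycle d, γ.1 = σ.cycleOf x :=
    ⟨⟨σ.cycleOf x, Equiv.Perm.isCycle_cycleOf σ hx, (hσ x).subset fun y hy => hs y hy⟩, rfl⟩
  refine ⟨γ, fun y hy => ?_, ?_⟩
  · rw [FinCycle.mem_support, hγ] at hy
    rw [hγ, (hs y hy).cycleOf_apply]
  · rwa [FinCycle.mem_support, hγ, Equiv.Perm.cycleOf_apply_self]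

lemma permOf_cyclesOf (hσ : IsFiniteCyclePerm σ) : permOf (cyclesOf σ) = σ := by
  refine Equiv.ext fun x => ?_
  have hη := isCompatibleGas_cyclesOf σ
  by_cases hx : σ x = x
  · rw [hx]
    refine permOf_apply_eq_self hη fun γ hγ hxγ => (γ.mem_support x).1 hxγ ?_
    rw [← cyclesOf_ne_zero.1 hγ x hxγ, hx]
  · obtain ⟨γ, hγ, hxγ⟩ := hσ.exists_hasCycle hx
    rw [permOf_apply hη (cyclesOf_ne_zero.2 hγ) hxγ, hγ x hxγ]

lemma isFiniteCyclePerm_of_permIn {Λ : Finset (Site d)} (σ : PermIn Λ) :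
    IsFiniteCyclePerm σ.1 := by
  intro x
  refine (Λ.finite_toSet.union (Set.finite_singleton x)).subset fun y hy => ?_
  by_cases hyΛ : y ∈ Λ
  · exact Or.inl hyΛ
  · refine Or.inr ?_
    obtain ⟨i, hi⟩ := Equiv.Perm.SameCycle.symm hy
    rw [Equiv.Perm.zpow_apply_eq_self_of_apply_eq_self (σ.2 y hyΛ)] at hi
    exact hi

/-! ### Topology and measurability -/

lemma measurable_perm_iff {Ω : Type*} [MeasurableSpace Ω] {f : Ω → Permutation d} :
    Measurable f ↔ ∀ x, Measurable fun ω => f ω x := by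
  have h : permMeasurableSpace d = MeasurableSpace.comap
      (fun (σ : Permutation d) (x : Site d) => σ x) inferInstance := by
    refine borel_comap.trans ?_
    rw [← BorelSpace.measurable_eq (α := Site d → Site d)]
  rw [h, measurable_comap_iff]
  exact measurable_pi_iff

lemma measurable_perm_apply (x : Site d) : Measurable fun σ : Permutation d => σ x :=
  measurable_perm_iff.1 measurable_id x

lemma measurable_cyclesOf : Measurable (cyclesOf (d := d)) := by
  classical
  refine measurable_pi_iff.2 fun γ => ?_
  have h : MeasurableSet {σ : Permutation d | HasCycle σ γ} := by
    have : {σ : Permutation d | HasCycle σ γ} = ⋂ x ∈ γ.support, {σ | σ x = γ.1 x} := by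
      ext σ
      simp [HasCycle]
    exact this ▸ Finset.measurableSet_biInter _ fun x _ =>
      measurable_perm_apply x (measurableSet_singleton _)
  exact Measurable.ite h measurable_const measurable_const

lemma measurableSet_isCompatibleGas : MeasurableSet {η : Config d | IsCompatibleGas η} := by
  have h : ∀ (γ : FinCycle d) (s : Set ℕ), MeasurableSet {η : Config d | η γ ∈ s} := fun γ s =>
    measurable_pi_apply γ (MeasurableSet.of_discrete (s := s))
  have : {η : Config d | IsCompatibleGas η} = (⋂ γ, {η : Config d | η γ ∈ {n | n ≤ 1}}) ∩
      ⋂ γ, ⋂ γ', ⋂ (_ : γ ≠ γ' ∧ Incompatible γ γ'),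
        ({η : Config d | η γ ∈ ({0} : Set ℕ)} ∪ {η | η γ' ∈ ({0} : Set ℕ)}) := by
    ext η
    simp only [IsCompatibleGas, Set.mem_inter_iff, Set.mem_iInter, Set.mem_union,
      Set.mem_ofPred_eq, Set.mem_singleton_iff]
    refine and_congr_right fun _ => forall₂_congr fun γ γ' => ?_
    tauto
  rw [this]
  exact (MeasurableSet.iInter fun γ => h γ _).inter (MeasurableSet.iInter fun γ =>
    MeasurableSet.iInter fun γ' => MeasurableSet.iInter fun _ => (h γ _).union (h γ' _))

lemma measurable_permOf : Measurable (permOf (d := d)) := by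
  refine measurable_perm_iff.2 fun x => measurable_to_countable' fun y => ?_
  have h : ∀ (γ : FinCycle d), MeasurableSet {η : Config d | η γ ≠ 0} := fun γ =>
    measurable_pi_apply γ (MeasurableSet.of_discrete (s := {0}ᶜ))
  have h1 : MeasurableSet {η : Config d | ∃ γ, (x ∈ γ.support ∧ γ.1 x = y) ∧ η γ ≠ 0} := by
    have : {η : Config d | ∃ γ, (x ∈ γ.support ∧ γ.1 x = y) ∧ η γ ≠ 0} =
        ⋃ γ, ⋃ (_ : x ∈ γ.support ∧ γ.1 x = y), {η : Config d | η γ ≠ 0} := by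
      ext η
      simp only [Set.mem_iUnion, Set.mem_ofPred_eq, exists_prop]
    exact this ▸ MeasurableSet.iUnion fun γ => MeasurableSet.iUnion fun _ => h γ
  have h2 : MeasurableSet {η : Config d | y = x ∧ ∀ γ, x ∈ γ.support → ¬ η γ ≠ 0} := by
    have : {η : Config d | y = x ∧ ∀ γ, x ∈ γ.support → ¬ η γ ≠ 0} =
        {_η | y = x} ∩ ⋂ γ, ⋂ (_ : x ∈ γ.support), {η : Config d | η γ ≠ 0}ᶜ := by
      ext η
      simp only [Set.mem_inter_iff, Set.mem_iInter, Set.mem_ofPred_eq, Set.mem_compl_iff]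
    exact this ▸ (MeasurableSet.const _).inter (MeasurableSet.iInter fun γ =>
      MeasurableSet.iInter fun _ => (h γ).compl)
  have key : (fun η : Config d => permOf η x) ⁻¹' {y} =
      ({η | IsCompatibleGas η} ∩ ({η | ∃ γ, (x ∈ γ.support ∧ γ.1 x = y) ∧ η γ ≠ 0} ∪
        {η | y = x ∧ ∀ γ, x ∈ γ.support → ¬ η γ ≠ 0})) ∪
      ({η | IsCompatibleGas η}ᶜ ∩ {_η | x = y}) := by
    ext η
    by_cases hη : IsCompatibleGas η
    · simp only [Set.mem_preimage, Set.mem_singleton_iff, Set.mem_union, Set.mem_inter_iff,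
        Set.mem_ofPred_eq, Set.mem_compl_iff, hη, true_and, not_true, false_and, or_false]
      by_cases hex : ∃ γ, η γ ≠ 0 ∧ x ∈ γ.support
      · obtain ⟨γ, hγ, hx⟩ := hex
        rw [permOf_apply hη hγ hx]
        refine ⟨fun h => Or.inl ⟨γ, ⟨hx, h⟩, hγ⟩, ?_⟩
        rintro (⟨γ', ⟨hx', h⟩, hγ'⟩ | ⟨-, h⟩)
        · rwa [hη.unique hγ hγ' hx hx']
        · exact absurd hγ (h γ hx)
      · push Not at hex
        rw [permOf_apply_eq_self hη hex]
        refine ⟨fun h => Or.inr ⟨h.symm, fun γ hx hγ => hex γ hγ hx⟩, ?_⟩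
        rintro (⟨γ, ⟨hx, -⟩, hγ⟩ | ⟨h, -⟩)
        · exact absurd hx (hex γ hγ)
        · exact h.symm
    · simp [hη, permOf]
  rw [key]
  exact (measurableSet_isCompatibleGas.inter (h1.union h2)).union
    (measurableSet_isCompatibleGas.compl.inter (MeasurableSet.const _))

lemma measurableSet_permOf_cyclesOf_eq :
    MeasurableSet {σ : Permutation d | permOf (cyclesOf σ) = σ} := by
  have : {σ : Permutation d | permOf (cyclesOf σ) = σ} =
      ⋂ x, {σ | permOf (cyclesOf σ) x = σ x} := by
    ext σ
    simp only [Set.mem_iInter, Set.mem_ofPred_eq]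
    exact Equiv.ext_iff
  rw [this]
  refine MeasurableSet.iInter fun x => ?_
  exact measurableSet_eq_fun ((measurable_perm_apply x).comp (measurable_permOf.comp
    measurable_cyclesOf)) (measurable_perm_apply x)

lemma tendsto_perm_of_eventually_eq {ι : Type*} {l : Filter ι} {f : ι → Permutation d}
    (h : ∀ x, ∀ᶠ i in l, f i x = σ x) : Tendsto f l (𝓝 σ) := by
  rw [nhds_induced, tendsto_comap_iff, tendsto_pi_nhds]
  exact fun x => tendsto_const_nhds.congr' ((h x).mono fun i hi => hi.symm)

instance permMetrizableSpace : TopologicalSpace.MetrizableSpace (Permutation d) :=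
  Topology.IsEmbedding.metrizableSpace (f := fun (σ : Permutation d) (x : Site d) => σ x)
    ⟨⟨rfl⟩, fun _ _ h => Equiv.ext (congrFun h)⟩

/-! ### The Gibbs weight of a permutation -/

lemma boltzmann_add {α : ℝ} (hα : 0 < α) (E E' : ℝ≥0∞) :
    boltzmann α (E + E') = boltzmann α E * boltzmann α E' := by
  have h1 : ∀ E : ℝ≥0∞, EReal.exp (α * (E : EReal)) ≠ 0 := fun E => by
    refine (lt_of_lt_of_le one_pos ?_).ne'
    rw [EReal.one_le_exp_iff]
    exact mul_nonneg (by exact_mod_cast hα.le) (EReal.coe_ennreal_nonneg E)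
  simp only [boltzmann, EReal.exp_neg]
  rw [EReal.coe_ennreal_add, EReal.left_distrib_of_nonneg (EReal.coe_ennreal_nonneg E)
    (EReal.coe_ennreal_nonneg E'), EReal.exp_add, ENNReal.mul_inv (Or.inl (h1 E))
    (Or.inr (h1 E'))]

lemma boltzmann_sum {α : ℝ} (hα : 0 < α) {ι : Type*} (s : Finset ι) (f : ι → ℝ≥0∞) :
    boltzmann α (∑ i ∈ s, f i) = ∏ i ∈ s, boltzmann α (f i) := by
  classical
  induction s using Finset.induction_on with
  | empty => simp [boltzmann]
  | insert i s hi ih => rw [Finset.sum_insert hi, Finset.prod_insert hi, boltzmann_add hα, ih]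

/-- The Gibbs weight of a permutation is the product of the weights of its cycles; here `V 0 = 0`
accounts for the fixed points. -/
lemma boltzmann_hamiltonian {V : Site d → ℝ≥0∞} (hV : V 0 = 0) {α : ℝ} (hα : 0 < α)
    {Λ : Finset (Site d)} (σ : PermIn Λ) : boltzmann α (hamiltonian V Λ σ.1) =
      ∏ γ ∈ cyclesIn Λ, weight V α γ ^ cyclesOf σ.1 γ := by
  classical
  have h1 : ∏ γ ∈ cyclesIn Λ, weight V α γ ^ cyclesOf σ.1 γ =
      ∏ γ ∈ (cyclesIn Λ).filter (HasCycle σ.1), weight V α γ := by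
    rw [Finset.prod_filter]
    refine Finset.prod_congr rfl fun γ _ => ?_
    rw [cyclesOf_apply]
    split_ifs <;> simp
  have h2 : hamiltonian V Λ σ.1 = ∑ γ ∈ (cyclesIn Λ).filter (HasCycle σ.1),
      ∑ x ∈ γ.support, V (γ.1 x - x) := by
    have h3 : ∑ γ ∈ (cyclesIn Λ).filter (HasCycle σ.1), ∑ x ∈ γ.support, V (γ.1 x - x) =
        ∑ γ ∈ (cyclesIn Λ).filter (HasCycle σ.1), ∑ x ∈ γ.support, V (σ.1 x - x) :=
      Finset.sum_congr rfl fun γ hγ => Finset.sum_congr rfl fun x hx => by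
        rw [(Finset.mem_filter.1 hγ).2 x hx]
    rw [h3, ← Finset.sum_biUnion, hamiltonian]
    · symm
      refine Finset.sum_subset (fun x hx => ?_) fun x hx hn => ?_
      · obtain ⟨γ, hγ, hx⟩ := Finset.mem_biUnion.1 hx
        exact mem_cyclesIn.1 (Finset.mem_filter.1 hγ).1 hx
      · have : σ.1 x = x := by
          by_contra hc
          obtain ⟨γ, hγ, hxγ⟩ := (isFiniteCyclePerm_of_permIn σ).exists_hasCycle hc
          refine hn (Finset.mem_biUnion.2 ⟨γ, Finset.mem_filter.2 ⟨mem_cyclesIn.2 fun y hy => ?_,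
            hγ⟩, hxγ⟩)
          by_contra hyΛ
          exact (γ.mem_support y).1 hy ((hγ y hy).symm.trans (σ.2 y hyΛ))
        rw [this, sub_self, hV]
    · intro γ hγ γ' hγ' hne
      refine Finset.disjoint_left.2 fun x hx hx' => hne ?_
      exact (Finset.mem_filter.1 hγ).2.unique (Finset.mem_filter.1 hγ').2 hx hx'
  rw [h1, h2, boltzmann_sum hα]
  rfl

end Permutations

end CycleGas

namespace CycleGas

/-! ### The thermodynamic limit -/

section Limit

variable {d : ℕ} {V : Site d → ℝ≥0∞} {α : ℝ} {Ω : Type*} [MeasurableSpace Ω] {P : Measure Ω}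
  {N : Ω → Set (Point d)}

lemma support_subset_of_lossNetwork_restrictTo_ne_zero {M : Set (Point d)} {Λ : Finset (Site d)}
    {t : ℝ} {γ : FinCycle d} (h : lossNetwork (restrictTo M Λ) t γ ≠ 0) : γ.support ⊆ Λ := by
  obtain ⟨φ, hφ, rfl, -⟩ := Set.nonempty_of_ncard_ne_zero h
  exact fun x hx => Finset.mem_coe.1 ((kept_subset _ hφ).2 (Finset.mem_coe.2 hx))

/-- In a finite volume, the permutation of the loss network has law `G_Λ`. -/
theorem map_permOf_lossNetwork_restrictTo [IsProbabilityMeasure P] (hV : V 0 = 0) (hα : 0 < α)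
    (hN : IsPoissonProcess N (intensity V α) P)
    (hclan : ∀ᵐ ω ∂P, ∀ φ : Point d, (clan (N ω) φ).Finite) (Λ : Finset (Site d)) (t : ℝ) :
    P.map (fun ω => permOf (lossNetwork (restrictTo (N ω) Λ) t)) = specMeasure V α Λ := by
  have hmL := aemeasurable_lossNetwork_restrictTo hα hN hclan Λ t
  have hmX : AEMeasurable (fun ω => permOf (lossNetwork (restrictTo (N ω) Λ) t)) P :=
    measurable_permOf.comp_aemeasurable hmL
  have hgas : ∀ᵐ ω ∂P, IsCompatibleGas (lossNetwork (restrictTo (N ω) Λ) t) := by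
    filter_upwards [hclan, ae_birth_injective hα hN] with ω h1 h2
    exact isCompatibleGas_lossNetwork (finite_clan_mono (restrictTo_subset _ _) h1)
      fun φ hφ ψ hψ => h2 φ hφ.1 ψ hψ.1
  set p : ℝ≥0∞ := P {ω | lossNetwork (restrictTo (N ω) Λ) t = 0} with hp
  have hprob : ∀ σ : PermIn Λ, P {ω | lossNetwork (restrictTo (N ω) Λ) t = cyclesOf σ.1} =
      boltzmann α (hamiltonian V Λ σ.1) * p := by
    intro σ
    rw [boltzmann_hamiltonian hV hα, hp]
    refine measure_lossNetwork_restrictTo_eq hα hN hclan Λ t (isCompatibleGas_cyclesOf σ.1)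
      fun γ hγ x hx => ?_
    by_contra hxΛ
    exact (γ.mem_support x).1 hx ((cyclesOf_ne_zero.1 hγ x hx).symm.trans (σ.2 x hxΛ))
  have hmeas : ∀ s : Set (Permutation d), MeasurableSet s →
      P.map (fun ω => permOf (lossNetwork (restrictTo (N ω) Λ) t)) s =
        ∑' σ : PermIn Λ, boltzmann α (hamiltonian V Λ σ.1) * p * Measure.dirac σ.1 s := by
    intro s hs
    rw [Measure.map_apply_of_aemeasurable hmX hs]
    have e : (fun ω => permOf (lossNetwork (restrictTo (N ω) Λ) t)) ⁻¹' s =ᵐ[P]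
        ⋃ σ : PermIn Λ, {ω | lossNetwork (restrictTo (N ω) Λ) t = cyclesOf σ.1 ∧ σ.1 ∈ s} := by
      filter_upwards [hgas] with ω hω
      refine propext ?_
      change permOf (lossNetwork (restrictTo (N ω) Λ) t) ∈ s ↔ ω ∈ ⋃ σ : PermIn Λ, _
      simp only [Set.mem_iUnion, Set.mem_ofPred_eq]
      constructor
      · intro h
        refine ⟨⟨permOf (lossNetwork (restrictTo (N ω) Λ) t), fun x hx => ?_⟩,
          (cyclesOf_permOf hω).symm, h⟩
        exact permOf_apply_eq_self hω fun γ hγ hxγ =>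
          hx (support_subset_of_lossNetwork_restrictTo_ne_zero hγ hxγ)
      · rintro ⟨σ, h1, h2⟩
        rwa [h1, permOf_cyclesOf (isFiniteCyclePerm_of_permIn σ)]
    rw [measure_congr e, measure_iUnion₀]
    · refine tsum_congr fun σ => ?_
      rw [Measure.dirac_apply' _ hs, ← hprob σ]
      by_cases h : σ.1 ∈ s <;> simp [h]
    · intro σ σ' hne
      refine Disjoint.aedisjoint (Set.disjoint_left.2 fun ω h h' => hne (Subtype.ext ?_))
      rw [← permOf_cyclesOf (isFiniteCyclePerm_of_permIn σ), ← h.1, h'.1,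
        permOf_cyclesOf (isFiniteCyclePerm_of_permIn σ')]
    · intro σ
      exact (hmL.nullMeasurableSet_preimage (measurableSet_singleton _)).inter
        (MeasurableSet.const _).nullMeasurableSet
  -- The total mass is `1`, so that the constant `p` is the inverse of the partition function.
  have hZ : partitionFunction V α Λ * p = 1 := by
    have h1 := hmeas Set.univ MeasurableSet.univ
    have : IsProbabilityMeasure (P.map fun ω => permOf (lossNetwork (restrictTo (N ω) Λ) t)) :=
      Measure.isProbabilityMeasure_map hmX
    simp only [measure_univ, mul_one] at h1
    rw [partitionFunction, ← ENNReal.tsum_mul_right, ← h1]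
  have hp' : p = (partitionFunction V α Λ)⁻¹ := by
    rw [mul_comm] at hZ
    exact ENNReal.eq_inv_of_mul_eq_one_left hZ
  refine Measure.ext fun s hs => ?_
  rw [hmeas s hs, specMeasure, Measure.sum_apply _ hs]
  refine tsum_congr fun σ => ?_
  rw [Measure.smul_apply, smul_eq_mul, hp', div_eq_mul_inv]

lemma ae_isCompatibleGas_lossNetwork [IsProbabilityMeasure P] (hα : 0 < α)
    (hN : IsPoissonProcess N (intensity V α) P)
    (hclan : ∀ᵐ ω ∂P, ∀ φ : Point d, (clan (N ω) φ).Finite) (t : ℝ) :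
    ∀ᵐ ω ∂P, IsCompatibleGas (lossNetwork (N ω) t) := by
  filter_upwards [hclan, ae_birth_injective hα hN] with ω h1 h2
  exact isCompatibleGas_lossNetwork h1 h2

lemma aemeasurable_lossNetwork (hα : 0 < α) (hN : IsPoissonProcess N (intensity V α) P)
    (hclan : ∀ᵐ ω ∂P, ∀ φ : Point d, (clan (N ω) φ).Finite) (t : ℝ) :
    AEMeasurable (fun ω => lossNetwork (N ω) t) P := by
  refine aemeasurable_pi_lambda _ fun γ => aemeasurable_of_tendsto_metrizable_ae
    (atTop : Filter (Finset (Site d)))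
    (f := fun (Λ : Finset (Site d)) ω => lossNetwork (restrictTo (N ω) Λ) t γ) (fun Λ => ?_) ?_
  · exact (measurable_pi_apply γ).comp_aemeasurable
      (aemeasurable_lossNetwork_restrictTo hα hN hclan Λ t)
  · filter_upwards [hclan, ae_birth_ne hN t] with ω h1 h2
    obtain ⟨x, hx⟩ := γ.support_nonempty
    obtain ⟨F, hF⟩ := exists_finset_lossNetwork_restrictTo_eq h1 h2 x
    refine tendsto_const_nhds.congr' ?_
    filter_upwards [eventually_ge_atTop F] with Λ hΛ
    exact (hF Λ (Finset.coe_subset.2 hΛ) γ hx).symm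

/-- Almost surely, the permutations of the finite volumes converge to that of the infinite
volume. -/
lemma ae_tendsto_permOf_lossNetwork [IsProbabilityMeasure P] (hα : 0 < α)
    (hN : IsPoissonProcess N (intensity V α) P)
    (hclan : ∀ᵐ ω ∂P, ∀ φ : Point d, (clan (N ω) φ).Finite) (t : ℝ) :
    ∀ᵐ ω ∂P, Tendsto (fun Λ : Finset (Site d) => permOf (lossNetwork (restrictTo (N ω) Λ) t)) atTop
      (𝓝 (permOf (lossNetwork (N ω) t))) := by
  filter_upwards [hclan, ae_birth_ne hN t, ae_birth_injective hα hN] with ω h1 h2 h3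
  refine tendsto_perm_of_eventually_eq fun x => ?_
  obtain ⟨F, hF⟩ := exists_finset_lossNetwork_restrictTo_eq h1 h2 x
  filter_upwards [eventually_ge_atTop F] with Λ hΛ
  exact permOf_congr (isCompatibleGas_lossNetwork (finite_clan_mono (restrictTo_subset _ _) h1)
    fun φ hφ ψ hψ => h3 φ hφ.1 ψ hψ.1) (isCompatibleGas_lossNetwork h1 h3)
    (hF Λ (Finset.coe_subset.2 hΛ))

/-- The law of the permutation of the infinite-volume loss network at time `t`. -/
noncomputable def limitLaw [IsProbabilityMeasure P] (hα : 0 < α)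
    (hN : IsPoissonProcess N (intensity V α) P)
    (hclan : ∀ᵐ ω ∂P, ∀ φ : Point d, (clan (N ω) φ).Finite) (t : ℝ) :
    ProbabilityMeasure (Permutation d) :=
  ⟨P.map fun ω => permOf (lossNetwork (N ω) t), Measure.isProbabilityMeasure_map
    (measurable_permOf.comp_aemeasurable (aemeasurable_lossNetwork hα hN hclan t))⟩

theorem tendsto_specification_limitLaw [IsProbabilityMeasure P] (hV : V 0 = 0) (hα : 0 < α)
    (hN : IsPoissonProcess N (intensity V α) P)
    (hclan : ∀ᵐ ω ∂P, ∀ φ : Point d, (clan (N ω) φ).Finite) (t : ℝ) :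
    Tendsto (fun Λ : Finset (Site d) => specification V hV α hα Λ) atTop
      (𝓝 (limitLaw hα hN hclan t)) := by
  rw [ProbabilityMeasure.tendsto_iff_forall_lintegral_tendsto]
  intro f
  have hf : Measurable fun σ : Permutation d => (f σ : ℝ≥0∞) :=
    measurable_coe_nnreal_ennreal.comp f.continuous.measurable
  have hm : ∀ Λ : Finset (Site d),
      AEMeasurable (fun ω => permOf (lossNetwork (restrictTo (N ω) Λ) t)) P := fun Λ =>
    measurable_permOf.comp_aemeasurable (aemeasurable_lossNetwork_restrictTo hα hN hclan Λ t)
  have hm' : AEMeasurable (fun ω => permOf (lossNetwork (N ω) t)) P :=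
    measurable_permOf.comp_aemeasurable (aemeasurable_lossNetwork hα hN hclan t)
  have e : ∀ Λ : Finset (Site d), ∫⁻ σ, f σ ∂(specification V hV α hα Λ : Measure (Permutation d)) =
      ∫⁻ ω, f (permOf (lossNetwork (restrictTo (N ω) Λ) t)) ∂P := fun Λ => by
    rw [← lintegral_map' hf.aemeasurable (hm Λ),
      map_permOf_lossNetwork_restrictTo hV hα hN hclan Λ t]
    rfl
  have e' : ∫⁻ σ, f σ ∂(limitLaw hα hN hclan t : Measure (Permutation d)) =
      ∫⁻ ω, f (permOf (lossNetwork (N ω) t)) ∂P := lintegral_map' hf.aemeasurable hm'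
  simp only [e, e']
  obtain ⟨C, hC⟩ : ∃ C : ℝ≥0, ∀ σ, f σ ≤ C :=
    ⟨nndist f 0, fun σ => by simpa using f.nndist_coe_le_nndist (g := 0) σ⟩
  refine tendsto_lintegral_filter_of_dominated_convergence' (fun _ => (C : ℝ≥0∞))
    (Eventually.of_forall fun Λ => ?_) (Eventually.of_forall fun Λ => ?_) ?_ ?_
  · exact hf.comp_aemeasurable (hm Λ)
  · exact Eventually.of_forall fun ω => ENNReal.coe_le_coe.2 (hC _)
  · simp
  · filter_upwards [ae_tendsto_permOf_lossNetwork hα hN hclan t] with ω hω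
    exact (ENNReal.continuous_coe.comp f.continuous).continuousAt.tendsto.comp hω

end Limit

end CycleGas

theorem mainTheorem4 {d : ℕ} (V : Site d → ℝ≥0∞) (hV : V 0 = 0) (α : ℝ) (hα : 0 < α)
    {Ω : Type*} [MeasurableSpace Ω] (P : Measure Ω) [IsProbabilityMeasure P]
    (N : Ω → Set (Point d)) (hN : IsPoissonProcess N (intensity V α) P)
    (hclan : ∀ᵐ ω ∂P, ∀ φ : Point d, (clan (N ω) φ).Finite) :
    (∀ (t : ℝ) (γ : FinCycle d), ∀ᵐ ω ∂P,
      Tendsto (fun Λ : Set (Site d) => lossNetwork (restrictTo (N ω) Λ) t γ) (exhaustion d)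
        (𝓝 (lossNetwork (N ω) t γ))) ∧
    ∃ μ : ProbabilityMeasure (Permutation d),
      (∀ᵐ σ ∂(μ : Measure (Permutation d)), IsFiniteCyclePerm σ) ∧
      (∀ t : ℝ, HasLaw (fun ω => lossNetwork (N ω) t)
        ((μ : Measure (Permutation d)).map cyclesOf) P) ∧
      Tendsto (fun Λ : Finset (Site d) => specification V hV α hα Λ) atTop (𝓝 μ) := by
  refine ⟨fun t γ => ?_, limitLaw hα hN hclan 0, ?_, fun t => ?_,
    tendsto_specification_limitLaw hV hα hN hclan 0⟩
  · filter_upwards [hclan, ae_birth_ne hN t] with ω h1 h2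
    obtain ⟨x, hx⟩ := γ.support_nonempty
    obtain ⟨F, hF⟩ := exists_finset_lossNetwork_restrictTo_eq h1 h2 x
    refine tendsto_const_nhds.congr' ?_
    filter_upwards [mem_iInf_of_mem F (mem_principal_self _)] with Λ hΛ
    exact (hF Λ hΛ γ hx).symm
  · have h : ∀ᵐ σ ∂(limitLaw hα hN hclan 0 : Measure (Permutation d)),
        permOf (cyclesOf σ) = σ := by
      refine (ae_map_iff (measurable_permOf.comp_aemeasurable
        (aemeasurable_lossNetwork hα hN hclan 0)) measurableSet_permOf_cyclesOf_eq).2 ?_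
      filter_upwards [ae_isCompatibleGas_lossNetwork hα hN hclan 0] with ω hω
      exact congrArg permOf (cyclesOf_permOf hω)
    filter_upwards [h] with σ hσ
    exact hσ ▸ isFiniteCyclePerm_permOf (isCompatibleGas_cyclesOf σ)
  · have hm := aemeasurable_lossNetwork hα hN hclan t
    refine ⟨hm, ?_⟩
    -- The laws at different times are limits of the same specifications, so they agree.
    rw [tendsto_nhds_unique (tendsto_specification_limitLaw hV hα hN hclan 0)
      (tendsto_specification_limitLaw hV hα hN hclan t)]
    change _ = (P.map fun ω => permOf (lossNetwork (N ω) t)).map cyclesOf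
    have hX : AEMeasurable (fun ω => permOf (lossNetwork (N ω) t)) P :=
      measurable_permOf.comp_aemeasurable hm
    rw [AEMeasurable.map_map_of_aemeasurable measurable_cyclesOf.aemeasurable hX]
    refine Measure.map_congr ?_
    filter_upwards [ae_isCompatibleGas_lossNetwork hα hN hclan t] with ω hω
    exact (cyclesOf_permOf hω).symm
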